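/- Let $m\ge n\ge 1$ and $k\ge 0$ be integers. For $r\ge 1$ let $\vec 1_r=(\tfrac1{\sqrt r},\dots,\tfrac1{\sqrt r})^T\in\mathbb R^r$, and for a square matrix $M$ let $\chi(M)=\det(xI-M)$. Let $A_1,\dots,A_k$ be real $m\times n$ matrices, $a_1,\dots,a_k$ real numbers and $p_1,\dots,p_k$ real polynomials such that for every $i$ $$A_i\vec 1_n=a_i\vec 1_m,\qquad A_i^T\vec 1_m=a_i\vec 1_n,\qquad \chi(A_i^TA_i)=(x-a_i^2)\,p_i(x).$$ Let $P_1,\dots,P_k$ be uniformly random $m\times m$ permutation matrices and $S_1,\dots,S_k$ uniformly random $n\times n$ permutation matrices, all independent. Then $$\mathbb E_{P_1,\dots,P_k,\,S_1,\dots,S_k}\;\chi\!\left(\sum_{i=1}^k (P_i\oplus S_i)\begin{pmatrix}0&A_i\\A_i^T&0\end{pmatrix}(P_i\oplus S_i)^T\right)=x^{m-n}\left(x^2-\Big(\sum_{i=1}^k a_i\Big)^2\right)\mathbb S\big(p_1\boxplus\cdots\boxplus p_k\big).$$ Here $P\oplus S=\begin{pmatrix}P&0\\0&S\end{pmatrix}$,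 the expectation of a polynomial is taken coefficientwise, $(\mathbb S p)(x)=p(x^2)$, and $\boxplus=\boxplus_{m-1,n-1}$, where for integers $M\ge N\ge 0$ and polynomials $p=\sum_{i=0}^N(-1)^i\alpha_i x^{N-i}$ and $q=\sum_{i=0}^N(-1)^i\beta_i x^{N-i}$ $$p\boxplus_{M,N}q=\sum_{\ell=0}^N(-1)^\ell x^{N-\ell}\sum_{i+j=\ell}\frac{(N-i)!\,(N-j)!}{N!\,(N-\ell)!}\cdot\frac{(M-i)!\,(M-j)!}{M!\,(M-\ell)!}\,\alpha_i\beta_j .$$ The iterated convolution is evaluated from left to right, and for $k=0$ it is the neutral element $x^{n-1}$. -/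

import Mathlib

open Polynomial
open scoped BigOperators

noncomputable section

/-- The normalized all-ones vector `(1/√r, …, 1/√r)` in `ℝ^r`. -/
def unitOnes (r : ℕ) : Fin r → ℝ := fun _ => 1 / Real.sqrt r

/-- The symmetric block matrix `[[0, A], [Aᵀ, 0]]` of a rectangular matrix `A`. -/
def bipartiteMatrix {m n : ℕ} (A : Matrix (Fin m) (Fin n) ℝ) :
    Matrix (Fin m ⊕ Fin n) (Fin m ⊕ Fin n) ℝ :=
  Matrix.fromBlocks 0 A A.transpose 0

/-- The block-diagonal matrix `P ⊕ S` of the permutation matrices of `σ` and `τ`. -/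
def permSum {m n : ℕ} (σ : Equiv.Perm (Fin m)) (τ : Equiv.Perm (Fin n)) :
    Matrix (Fin m ⊕ Fin n) (Fin m ⊕ Fin n) ℝ :=
  Matrix.fromBlocks (σ.permMatrix ℝ) 0 0 (τ.permMatrix ℝ)

/-- The operator `(S p)(x) = p(x²)` on polynomials. -/
def squareSubst (p : ℝ[X]) : ℝ[X] := p.comp (X ^ 2)

/-- The coefficient `a_i` in the expansion `p = ∑_{i=0}^n (-1)^i a_i x^(n-i)`, for `i ≤ n`. -/
def signedCoeff (n : ℕ) (p : ℝ[X]) (i : ℕ) : ℝ := (-1) ^ i * p.coeff (n - i)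

/-- The rectangular additive convolution `p ⊞_{m,n} q`, for `m ≥ n` and polynomials `p`, `q` of
degree `n`. -/
def rectConv (m n : ℕ) (p q : ℝ[X]) : ℝ[X] :=
  ∑ l ∈ Finset.range (n + 1),
    C ((-1) ^ l * ∑ ij ∈ Finset.HasAntidiagonal.antidiagonal l,
      (((n - ij.1).factorial * (n - ij.2).factorial : ℝ) / (n.factorial * (n - l).factorial)) *
      (((m - ij.1).factorial * (m - ij.2).factorial : ℝ) / (m.factorial * (m - l).factorial)) *
      signedCoeff n p ij.1 * signedCoeff n q ij.2) * X ^ (n - l)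

/-- The iterated convolution `(⋯((p₁ ⊞ p₂) ⊞ p₃)⋯) ⊞ p_k` with `⊞ = ⊞_{m,n}`; the empty one is
the neutral element `x^n`. -/
def rectConvList (m n : ℕ) : List ℝ[X] → ℝ[X]
  | [] => X ^ n
  | p :: ps => ps.foldl (rectConv m n) p

end

/-! The permutation average is traded for a signed-permutation average on the orthogonal complements
of the all-ones vectors, where determinants expand into minors.

The trade rests on `RowInvariant`: the sum over row permutations is unchanged when `B` is replaced
by `Q * B`. Suppose `Q` is a reflection along a sum-zero vector supported on three coordinates. On
the complexified plane of such vectors, all reflections have the form `z w wᵀ + z' w' w'ᵀ` with `w =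
(1, ω, ω²)`, `w' = (1, ω², ω)` and `z z' = 1/9`. The three-cycle multiplies `z` by `ω` and `z'` by
`ω²`. The determinant has degree at most two in each parameter, so its average over the cycle
depends only on `z z'` (`sum_cubeRoots_det_pencil`). Hence every such reflection behaves like a
transposition, which the permutation sum absorbs. Conjugation and induction on the support extend
this to all sum-zero vectors (`rowInvariant_householder`). Products of these reflections include the
signed permutations in a fixed orthonormal basis of the complement.

For two summands, these signed permutations may therefore be inserted and averaged over. The
all-ones singular pair splits off the factor `X ^ 2 - C ((a + b) ^ 2)`. On the complements,
averaging signs decouples the determinant into products of complementary principal minors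
(`sum_signs_det`), and averaging permutations makes the minors depend on their sizes alone. The
resulting weights are those of `rectConv` (`sum_signedPerm_charpoly`).

More summands follow by induction: with the earlier permutations fixed, the two-summand formula
applies, and `rectConv` is linear in its left argument. -/

noncomputable section

/-! ### Sign averages and expansions into principal minors -/

section PrincipalMinors

open Matrix

variable {ι R : Type*} [Fintype ι] [DecidableEq ι] [CommRing R]

/-- The matrix that agrees with `Y` on `I × I`, with `X` on `Iᶜ × Iᶜ`, and vanishes elsewhere. -/
def blockMix (Y X : Matrix ι ι R) (I : Finset ι) : Matrix ι ι R :=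
  Matrix.of fun a b => if a ∈ I then (if b ∈ I then Y a b else 0) else
    (if b ∈ I then 0 else X a b)

/-- The principal minor of `Z` on the index set `I`. -/
def prinMinor (Z : Matrix ι ι R) (I : Finset ι) : R := (blockMix Z 1 I).det

/-- A full-size factorization replaces the reordering of indices into block-diagonal form, so that
the determinant splits by multiplicativity. -/
theorem blockMix_eq_mul (Y X : Matrix ι ι R) (I : Finset ι) :
    blockMix Y X I = blockMix Y 1 I * blockMix 1 X I := by
  ext a b
  rw [Matrix.mul_apply]
  by_cases ha : a ∈ I
  · by_cases hb : b ∈ I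
    · rw [Finset.sum_eq_single b]
      · simp [blockMix, ha, hb]
      · intro c _ hc
        by_cases h : c ∈ I <;> simp [blockMix, ha, hb, h, Matrix.one_apply, hc]
      · simp
    · rw [Finset.sum_eq_zero]
      · simp [blockMix, ha, hb]
      · intro c _
        by_cases h : c ∈ I <;> simp [blockMix, ha, hb, h]
  · rw [Finset.sum_eq_single a]
    · simp [blockMix, ha]
    · intro c _ hc
      by_cases h : c ∈ I <;> simp [blockMix, ha, h, Matrix.one_apply, hc.symm]
    · simp

theorem det_blockMix (Y X : Matrix ι ι R) (I : Finset ι) :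
    (blockMix Y X I).det = prinMinor Y I * prinMinor X Iᶜ := by
  rw [blockMix_eq_mul, Matrix.det_mul, prinMinor, prinMinor]
  congr 2
  ext a b
  by_cases ha : a ∈ I <;> by_cases hb : b ∈ I <;> simp [blockMix, ha, hb]

theorem prinMinor_diagonal (d : ι → R) (I : Finset ι) :
    prinMinor (Matrix.diagonal d) I = ∏ a ∈ I, d a := by
  have : blockMix (Matrix.diagonal d) 1 I = Matrix.diagonal fun a => if a ∈ I then d a else 1 := by
    ext a b
    by_cases hab : a = b
    · subst hab; by_cases ha : a ∈ I <;> simp [blockMix, ha]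
    · by_cases ha : a ∈ I <;> by_cases hb : b ∈ I <;> simp [blockMix, ha, hb, hab]
  rw [prinMinor, this, Matrix.det_diagonal, Finset.prod_ite_mem, Finset.univ_inter]

/-- If `π` preserves `I`, each sign in `I` occurs twice and cancels. Otherwise some `c ∈ I` has `π c
∉ I`; the sign at `π c` then enters only the factor of `c`, and flipping it is a sign-reversing
involution. -/
theorem sum_signs_prod (I : Finset ι) (π : Equiv.Perm ι) :
    (∑ ε : ι → ℤˣ, ∏ a ∈ I, (((ε (π a) * ε a : ℤˣ) : ℤ) : R)) =
      if (∀ a, π a ∈ I ↔ a ∈ I) then 2 ^ Fintype.card ι else 0 := by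
  split_ifs with h
  · have : ∀ ε : ι → ℤˣ, ∏ a ∈ I, (((ε (π a) * ε a : ℤˣ) : ℤ) : R) = 1 := by
      intro ε
      have h1 : ∏ a ∈ I, ε (π a) = ∏ a ∈ I, ε a :=
        Finset.prod_bij (fun a _ => π a) (fun a ha => (h a).2 ha)
          (fun a _ b _ hab => π.injective hab)
          (fun b hb => ⟨π.symm b, by rw [← h]; simpa using hb, by simp⟩) (fun a _ => rfl)
      have h2 : ∏ a ∈ I, (ε (π a) * ε a) = 1 := by
        rw [Finset.prod_mul_distrib, h1, Int.units_mul_self]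
      have h3 := congrArg (fun u : ℤˣ => ((u : ℤ) : R)) h2
      simpa [Units.coe_prod] using h3
    rw [Finset.sum_congr rfl fun ε _ => this ε]
    simp
  · have hc : ∃ c, c ∈ I ∧ π c ∉ I := by
      by_contra! hcon
      apply h
      have himg : I.map π.toEmbedding = I := by
        apply Finset.eq_of_subset_of_card_le
        · intro x hx
          obtain ⟨y, hy, rfl⟩ := Finset.mem_map.1 hx
          exact hcon y hy
        · simp
      intro a
      refine ⟨fun ha => ?_, hcon a⟩
      rw [← himg] at ha
      obtain ⟨y, hy, hya⟩ := Finset.mem_map.1 ha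
      rwa [← π.injective hya]
    obtain ⟨c, hcI, hπc⟩ := hc
    have hflip : ∀ ε : ι → ℤˣ, (∏ a ∈ I, (((Function.update ε (π c) (-ε (π c)) (π a) *
        Function.update ε (π c) (-ε (π c)) a : ℤˣ) : ℤ) : R)) =
        - ∏ a ∈ I, (((ε (π a) * ε a : ℤˣ) : ℤ) : R) := by
      intro ε
      rw [← Finset.mul_prod_erase I _ hcI, ← Finset.mul_prod_erase I _ hcI]
      have h1 : c ≠ π c := fun e => hπc (e ▸ hcI)
      have h2 : ∀ a ∈ I.erase c, (((Function.update ε (π c) (-ε (π c)) (π a) *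
        Function.update ε (π c) (-ε (π c)) a : ℤˣ) : ℤ) : R) = (((ε (π a) * ε a : ℤˣ) : ℤ) : R) := by
        intro a ha
        have ha1 : π a ≠ π c := fun e => (Finset.ne_of_mem_erase ha) (π.injective e)
        have ha2 : a ≠ π c := fun e => hπc (e ▸ Finset.mem_of_mem_erase ha)
        rw [Function.update_of_ne ha1, Function.update_of_ne ha2]
      rw [Finset.prod_congr rfl h2, Function.update_self, Function.update_of_ne h1]
      simp
    refine Finset.sum_involution (fun ε _ => Function.update ε (π c) (-ε (π c))) ?_ ?_ ?_ ?_
    · intro ε _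
      rw [hflip, add_neg_cancel]
    · intro ε _ _ e
      have := congrFun e (π c)
      simp at this
    · simp
    · intro ε _
      simp

/-- Averaging over sign changes decouples a determinant into products of principal minors. -/
theorem sum_signs_det (X Y : Matrix ι ι R) :
    (∑ ε : ι → ℤˣ, (X + Matrix.of fun a b => (((ε a * ε b : ℤˣ) : ℤ) : R) * Y a b).det) =
      2 ^ Fintype.card ι * ∑ I : Finset ι, prinMinor Y I * prinMinor X Iᶜ := by
  -- In the Leibniz expansion, `I` records the positions where the entry of `Y` is chosen. Only
  -- permutations preserving `I` survive the sign average, and these are exactly the ones that can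
  -- contribute to the determinant of `blockMix Y X I`.
  simp_rw [← det_blockMix, Matrix.det_apply, Matrix.add_apply, Matrix.of_apply]
  rw [Finset.sum_comm, Finset.sum_comm (s := (Finset.univ : Finset (Finset ι))), Finset.mul_sum]
  refine Finset.sum_congr rfl fun π _ => ?_
  simp_rw [← Finset.smul_sum, mul_smul_comm]
  congr 1
  have h1 : ∀ ε : ι → ℤˣ, (∏ i, (X (π i) i + (((ε (π i) * ε i : ℤˣ) : ℤ) : R) * Y (π i) i)) =
      ∑ I : Finset ι, (∏ a ∈ I, (((ε (π a) * ε a : ℤˣ) : ℤ) : R)) *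
        ((∏ a ∈ I, Y (π a) a) * ∏ a ∈ Iᶜ, X (π a) a) := by
    intro ε
    simp_rw [add_comm (X _ _)]
    rw [Finset.prod_add, Finset.powerset_univ]
    refine Finset.sum_congr rfl fun I _ => ?_
    rw [Finset.prod_mul_distrib, Finset.compl_eq_univ_sdiff, mul_assoc]
  simp_rw [h1]
  rw [Finset.sum_comm, Finset.mul_sum]
  refine Finset.sum_congr rfl fun I _ => ?_
  rw [← Finset.sum_mul, sum_signs_prod]
  split_ifs with h
  · congr 1
    rw [← Finset.prod_mul_prod_compl I fun i => blockMix Y X I (π i) i]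
    congr 1
    · refine Finset.prod_congr rfl fun a ha => ?_
      simp [blockMix, ha, (h a).2 ha]
    · refine Finset.prod_congr rfl fun a ha => ?_
      have ha' : a ∉ I := by simpa using ha
      have ha'' : π a ∉ I := fun e => ha' ((h a).1 e)
      simp [blockMix, ha', ha'']
  · push Not at h
    obtain ⟨a, ha⟩ := h
    rw [Finset.prod_eq_zero (Finset.mem_univ a)]
    · simp
    · rcases ha with ⟨h1, h2⟩ | ⟨h1, h2⟩ <;> simp [blockMix, h1, h2]

/-- Conjugation by a diagonal sign matrix fixes `Matrix.diagonal d` and preserves determinants, so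
all terms of the sign average in `sum_signs_det` coincide. -/
theorem det_diagonal_add [IsDomain R] [CharZero R] (d : ι → R) (Z : Matrix ι ι R) :
    (Matrix.diagonal d + Z).det = ∑ I : Finset ι, prinMinor Z I * ∏ a ∈ Iᶜ, d a := by
  have h := sum_signs_det (Matrix.diagonal d) Z
  have h1 : ∀ ε : ι → ℤˣ, (Matrix.diagonal d +
      Matrix.of fun a b => (((ε a * ε b : ℤˣ) : ℤ) : R) * Z a b).det =
      (Matrix.diagonal d + Z).det := by
    intro ε
    have hs : ∀ a, (((ε a : ℤˣ) : ℤ) : R) * (((ε a : ℤˣ) : ℤ) : R) = 1 := by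
      intro a
      rcases Int.units_eq_one_or (ε a) with h | h <;> simp [h]
    have h2 : (Matrix.diagonal d + Matrix.of fun a b => (((ε a * ε b : ℤˣ) : ℤ) : R) * Z a b) =
        Matrix.diagonal (fun a => (((ε a : ℤˣ) : ℤ) : R)) * (Matrix.diagonal d + Z) *
          Matrix.diagonal (fun a => (((ε a : ℤˣ) : ℤ) : R)) := by
      ext a b
      rw [Matrix.mul_diagonal, Matrix.diagonal_mul, Matrix.add_apply, Matrix.add_apply,
        Matrix.of_apply]
      by_cases hab : a = b
      · subst hab
        simp only [Matrix.diagonal_apply_eq, Units.val_mul, Int.cast_mul]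
        linear_combination (-d a) * hs a
      · simp only [Matrix.diagonal_apply_ne _ hab, Units.val_mul, Int.cast_mul]
        ring
    rw [h2, Matrix.det_mul, Matrix.det_mul, Matrix.det_diagonal]
    have : (∏ a, (((ε a : ℤˣ) : ℤ) : R)) * (∏ a, (((ε a : ℤˣ) : ℤ) : R)) = 1 := by
      rw [← Finset.prod_mul_distrib]
      exact Finset.prod_eq_one fun a _ => hs a
    linear_combination (Matrix.diagonal d + Z).det * this
  rw [Finset.sum_congr rfl fun ε _ => h1 ε] at h
  simp_rw [prinMinor_diagonal] at h
  have h2 : (2 : R) ^ Fintype.card ι ≠ 0 := pow_ne_zero _ two_ne_zero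
  apply mul_left_cancel₀ h2
  rw [← h]
  simp

/-- The minor is the determinant of `blockMix Z 0 K` plus a diagonal matrix with ones outside `K`. A
principal minor of `blockMix Z 0 K` on a set not contained in `K` has a zero row. -/
theorem prinMinor_diagonal_add [IsDomain R] [CharZero R] (d : ι → R) (Z : Matrix ι ι R)
    (K : Finset ι) :
    prinMinor (Matrix.diagonal d + Z) K =
      ∑ I ∈ K.powerset, prinMinor Z I * ∏ a ∈ K \ I, d a := by
  have h1 : blockMix (Matrix.diagonal d + Z) 1 K =
      Matrix.diagonal (fun a => if a ∈ K then d a else 1) + blockMix Z 0 K := by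
    ext a b
    by_cases hab : a = b
    · subst hab; by_cases ha : a ∈ K <;> simp [blockMix, ha]
    · by_cases ha : a ∈ K <;> by_cases hb : b ∈ K <;> simp [blockMix, ha, hb, hab]
  rw [prinMinor, h1, det_diagonal_add]
  have h2 : ∀ I : Finset ι, prinMinor (blockMix Z 0 K) I = if I ⊆ K then prinMinor Z I else 0 := by
    intro I
    split_ifs with h
    · rw [prinMinor, prinMinor]
      congr 1
      ext a b
      by_cases ha : a ∈ I <;> by_cases hb : b ∈ I <;> simp [blockMix, ha, hb]
      simp [h ha, h hb]
    · obtain ⟨a, ha, haK⟩ := Finset.not_subset.1 h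
      apply Matrix.det_eq_zero_of_row_eq_zero a
      intro b
      simp [blockMix, ha, haK]
  simp_rw [h2, ite_mul, zero_mul]
  rw [← Finset.sum_filter]
  refine Finset.sum_congr (by ext; simp) fun I hI => ?_
  have hI' : I ⊆ K := by simpa using hI
  congr 1
  rw [Finset.prod_ite_mem]
  refine Finset.prod_congr ?_ fun _ _ => rfl
  ext a
  simp [and_comm]

theorem prinMinor_submatrix (Z : Matrix ι ι R) (π : Equiv.Perm ι) (I : Finset ι) :
    prinMinor (Z.submatrix π π) I = prinMinor Z (I.map π.toEmbedding) := by
  rw [prinMinor, prinMinor, ← Matrix.det_submatrix_equiv_self π (blockMix Z 1 _)]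
  congr 1
  ext a b
  simp [blockMix, Matrix.one_apply]

end PrincipalMinors

/-! ### Signed-permutation averages and the rectangular convolution -/

section PermutationAverage

open Matrix Finset

theorem exists_perm_map_eq {ι : Type*} [Fintype ι] [DecidableEq ι] {I J : Finset ι}
    (h : I.card = J.card) : ∃ σ : Equiv.Perm ι, I.map σ.toEmbedding = J := by
  have e : {x // x ∈ I} ≃ {x // x ∈ J} := Fintype.equivOfCardEq (by simpa using h)
  refine ⟨e.extendSubtype, Finset.eq_of_subset_of_card_le ?_ (by simp [h])⟩
  intro x hx
  obtain ⟨y, hy, rfl⟩ := Finset.mem_map.1 hx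
  exact e.extendSubtype_mem y hy

/-- Double counting: right translation shows that the left sum depends only on the size of `I`,
while each fixed `σ` permutes the subsets of that size. -/
theorem sum_perm_map {ι : Type*} [Fintype ι] [DecidableEq ι] (φ : Finset ι → ℝ) (I : Finset ι) :
    (∑ σ : Equiv.Perm ι, φ (I.map σ.toEmbedding)) * (Fintype.card ι).choose I.card =
      (Fintype.card ι).factorial * ∑ J ∈ powersetCard I.card univ, φ J := by
  have hL : ∀ J ∈ powersetCard I.card (univ : Finset ι),
      (∑ σ : Equiv.Perm ι, φ (J.map σ.toEmbedding)) =
        ∑ σ : Equiv.Perm ι, φ (I.map σ.toEmbedding) := by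
    intro J hJ
    obtain ⟨ρ, rfl⟩ := exists_perm_map_eq (Finset.mem_powersetCard.1 hJ).2.symm
    rw [← Equiv.sum_comp (Equiv.mulRight ρ) fun σ => φ (I.map σ.toEmbedding)]
    refine Finset.sum_congr rfl fun σ _ => ?_
    rw [Finset.map_map]
    rfl
  have h1 := Finset.sum_congr rfl hL
  rw [Finset.sum_const, Finset.card_powersetCard, Finset.card_univ, nsmul_eq_mul] at h1
  rw [mul_comm, ← h1, Finset.sum_comm]
  have h2 : ∀ σ : Equiv.Perm ι, (∑ J ∈ powersetCard I.card univ, φ (J.map σ.toEmbedding)) =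
      ∑ J ∈ powersetCard I.card univ, φ J := by
    intro σ
    refine Finset.sum_bij' (fun J _ => J.map σ.toEmbedding) (fun J _ => J.map σ.symm.toEmbedding)
      ?_ ?_ ?_ ?_ ?_
    · intro J hJ; simpa using hJ
    · intro J hJ; simpa using hJ
    · intro J _; ext; simp
    · intro J _; ext; simp
    · intro J _; rfl
  rw [Finset.sum_congr rfl fun σ _ => h2 σ]
  simp [Fintype.card_perm]

variable {M N : ℕ}

/-- The sum of the principal minors of `Z` with `i` indices in the first and `j` indices in the
second block. -/
def minorSum (Z : Matrix (Fin M ⊕ Fin N) (Fin M ⊕ Fin N) ℝ) (i j : ℕ) : ℝ :=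
  ∑ K ∈ powersetCard i (univ : Finset (Fin M)), ∑ L ∈ powersetCard j (univ : Finset (Fin N)),
    prinMinor Z (K.disjSum L)

theorem sum_finset_sumType {α β : Type*} [Fintype α] [Fintype β] [DecidableEq α] [DecidableEq β]
    (f : Finset (α ⊕ β) → ℝ) :
    ∑ I, f I = ∑ K : Finset α, ∑ L : Finset β, f (K.disjSum L) := by
  rw [← Fintype.sum_prod_type']
  exact (Equiv.sum_comp (Finset.sumEquiv (α := α) (β := β)).symm.toEquiv f).symm

theorem sum_sum_perm_prinMinor (Z : Matrix (Fin M ⊕ Fin N) (Fin M ⊕ Fin N) ℝ)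
    (K : Finset (Fin M)) (L : Finset (Fin N)) :
    (∑ σ : Equiv.Perm (Fin M), ∑ τ : Equiv.Perm (Fin N),
      prinMinor (Z.submatrix (Sum.map σ τ) (Sum.map σ τ)) (K.disjSum L)) =
      M.factorial * N.factorial / (M.choose K.card * N.choose L.card) *
        minorSum Z K.card L.card := by
  have h0 : ∀ (σ : Equiv.Perm (Fin M)) (τ : Equiv.Perm (Fin N)),
      prinMinor (Z.submatrix (Sum.map σ τ) (Sum.map σ τ)) (K.disjSum L) =
        prinMinor Z ((K.map σ.toEmbedding).disjSum (L.map τ.toEmbedding)) := by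
    intro σ τ
    have := prinMinor_submatrix Z (Equiv.sumCongr σ τ) (K.disjSum L)
    refine this.trans ?_
    congr 1
    ext (a | a) <;> simp
  have hM : (M.choose K.card : ℝ) ≠ 0 := by
    exact_mod_cast (Nat.choose_pos (by simpa using Finset.card_le_univ K)).ne'
  have hN : (N.choose L.card : ℝ) ≠ 0 := by
    exact_mod_cast (Nat.choose_pos (by simpa using Finset.card_le_univ L)).ne'
  simp_rw [h0]
  have h1 : ∀ K' : Finset (Fin M), (∑ τ : Equiv.Perm (Fin N),
      prinMinor Z (K'.disjSum (L.map τ.toEmbedding))) = N.factorial *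
        (∑ J ∈ powersetCard L.card univ, prinMinor Z (K'.disjSum J)) / N.choose L.card := by
    intro K'
    have := sum_perm_map (fun J => prinMinor Z (K'.disjSum J)) L
    rw [Fintype.card_fin] at this
    rw [← this, mul_div_cancel_right₀ _ hN]
  simp_rw [h1]
  have := sum_perm_map (fun K' => (N.factorial : ℝ) *
        (∑ J ∈ powersetCard L.card univ, prinMinor Z (K'.disjSum J)) / N.choose L.card) K
  rw [Fintype.card_fin] at this
  rw [← mul_div_cancel_right₀ (∑ σ : Equiv.Perm (Fin M), _) hM, this, minorSum,
    ← Finset.sum_div, ← Finset.mul_sum]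
  field_simp

theorem sum_diag_range (hNM : N ≤ M) (f : ℕ → ℕ → ℝ) (hf : ∀ i j, i ≠ j → f i j = 0) :
    ∑ i ∈ range (M + 1), ∑ j ∈ range (N + 1), f i j = ∑ i ∈ range (N + 1), f i i := by
  rw [Finset.sum_comm]
  refine Finset.sum_congr rfl fun j hj => ?_
  rw [Finset.sum_eq_single j]
  · intro i _ hij; exact hf i j hij
  · intro h
    simp at h hj
    omega

theorem sum_prinMinor_mul (Z : Matrix (Fin M ⊕ Fin N) (Fin M ⊕ Fin N) ℝ) (hNM : N ≤ M)
    (hZ : ∀ i j, i ≠ j → minorSum Z i j = 0) (h : ℕ → ℕ → ℝ) :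
    (∑ K : Finset (Fin M), ∑ L : Finset (Fin N),
      prinMinor Z (K.disjSum L) * h K.card L.card) =
      ∑ i ∈ range (N + 1), minorSum Z i i * h i i := by
  rw [← sum_diag_range hNM (fun i j => minorSum Z i j * h i j)
    (fun i j hij => by rw [hZ i j hij, zero_mul])]
  rw [← Finset.powerset_univ, Finset.sum_powerset, card_univ, Fintype.card_fin]
  refine Finset.sum_congr rfl fun i _ => ?_
  simp_rw [minorSum]
  rw [← Finset.powerset_univ]
  simp_rw [Finset.sum_powerset]
  rw [Finset.sum_comm]
  simp_rw [card_univ, Fintype.card_fin]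
  refine Finset.sum_congr rfl fun j _ => ?_
  rw [Finset.sum_mul]
  refine Finset.sum_congr rfl fun K hK => ?_
  rw [Finset.sum_mul]
  refine Finset.sum_congr rfl fun L hL => ?_
  rw [(mem_powersetCard.1 hK).2, (mem_powersetCard.1 hL).2]

theorem sum_powerset_card_diag (K : Finset (Fin M)) (L : Finset (Fin N)) (hNM : N ≤ M)
    (hKL : K.card = L.card) (g : ℕ → ℕ → ℝ) (hg : ∀ i j, i ≠ j → g i j = 0) :
    (∑ I ∈ Kᶜ.powerset, ∑ J ∈ Lᶜ.powerset, g I.card J.card) =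
      ∑ j ∈ range (N - L.card + 1),
        ((M - K.card).choose j * (N - L.card).choose j : ℝ) * g j j := by
  have h1 : ∀ i : ℕ, (∑ J ∈ Lᶜ.powerset, g i J.card) =
      ∑ j ∈ range (N - L.card + 1), ((N - L.card).choose j : ℝ) * g i j := by
    intro i
    rw [Finset.sum_powerset_apply_card, card_compl, Fintype.card_fin]
    simp
  simp_rw [h1]
  rw [Finset.sum_powerset_apply_card (fun i => ∑ j ∈ range (N - L.card + 1),
    ((N - L.card).choose j : ℝ) * g i j), card_compl, Fintype.card_fin]
  simp_rw [nsmul_eq_mul, Finset.mul_sum]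
  rw [sum_diag_range (by omega) fun i j => ((M - K.card).choose i : ℝ) *
    (((N - L.card).choose j : ℝ) * g i j)]
  · simp_rw [mul_assoc]
  · intro i j hij
    simp [hg i j hij]

/-- The left side is the probability that a random `j`-set misses a given `i`-set; the right side is
the factorial weight in `rectConv`. -/
theorem choose_ratio {M i j : ℕ} (h : i + j ≤ M) :
    ((M - i).choose j : ℝ) / M.choose j =
      ((M - i).factorial * (M - j).factorial : ℝ) / (M.factorial * (M - (i + j)).factorial) := by
  rw [Nat.cast_choose ℝ (by omega : j ≤ M - i), Nat.cast_choose ℝ (by omega : j ≤ M),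
    show M - i - j = M - (i + j) by omega]
  have h1 : (j.factorial : ℝ) ≠ 0 := by positivity
  have h2 : (M.factorial : ℝ) ≠ 0 := by positivity
  have h3 : ((M - (i + j)).factorial : ℝ) ≠ 0 := by positivity
  have h4 : ((M - j).factorial : ℝ) ≠ 0 := by positivity
  field_simp

/-- In a nonzero Leibniz term, `π` must carry `K` into `L` and `L` into `K`, because the diagonal
blocks vanish. -/
theorem prinMinor_neg_bipartite (A : Matrix (Fin M) (Fin N) ℝ) (K : Finset (Fin M))
    (L : Finset (Fin N)) (h : K.card ≠ L.card) :
    prinMinor (-bipartiteMatrix A) (K.disjSum L) = 0 := by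
  rw [prinMinor, Matrix.det_apply]
  refine Finset.sum_eq_zero fun π _ => ?_
  suffices hex : ∃ a, blockMix (-bipartiteMatrix A) 1 (K.disjSum L) (π a) a = 0 by
    obtain ⟨a, ha⟩ := hex
    rw [Finset.prod_eq_zero (f := fun i => blockMix (-bipartiteMatrix A) 1 (K.disjSum L) (π i) i)
      (Finset.mem_univ a) ha, smul_zero]
  by_contra! hcon
  apply h
  apply le_antisymm
  · have : K.map Function.Embedding.inl ⊆
        (L.map Function.Embedding.inr).map π.symm.toEmbedding := by
      intro x hx
      obtain ⟨a, ha, rfl⟩ := Finset.mem_map.1 hx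
      have h1 := hcon (Sum.inl a)
      rcases hb : π (Sum.inl a) with b | b
      · rw [Function.Embedding.inl_apply]
        rw [hb] at h1
        by_cases hbK : b ∈ K <;> simp [blockMix, bipartiteMatrix, ha, hbK] at h1
      · rw [hb] at h1
        by_cases hbL : b ∈ L
        · simp only [mem_map]
          exact ⟨_, ⟨b, hbL, rfl⟩, by simp [← hb]⟩
        · simp [blockMix, bipartiteMatrix, ha, hbL] at h1
    simpa using Finset.card_le_card this
  · have : L.map Function.Embedding.inr ⊆
        (K.map Function.Embedding.inl).map π.symm.toEmbedding := by
      intro x hx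
      obtain ⟨a, ha, rfl⟩ := Finset.mem_map.1 hx
      have h1 := hcon (Sum.inr a)
      rcases hb : π (Sum.inr a) with b | b
      · rw [hb] at h1
        by_cases hbK : b ∈ K
        · simp only [mem_map]
          exact ⟨_, ⟨b, hbK, rfl⟩, by simp [← hb]⟩
        · simp [blockMix, bipartiteMatrix, ha, hbK] at h1
      · rw [hb] at h1
        by_cases hbL : b ∈ L <;> simp [blockMix, bipartiteMatrix, ha, hbL] at h1
    simpa using Finset.card_le_card this

theorem minorSum_neg_bipartite (A : Matrix (Fin M) (Fin N) ℝ) (i j : ℕ) (h : i ≠ j) :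
    minorSum (-bipartiteMatrix A) i j = 0 := by
  refine Finset.sum_eq_zero fun K hK => Finset.sum_eq_zero fun L hL => ?_
  apply prinMinor_neg_bipartite
  rwa [(mem_powersetCard.1 hK).2, (mem_powersetCard.1 hL).2]

theorem eval_charpoly_bipartite (A : Matrix (Fin M) (Fin N) ℝ) (hNM : N ≤ M) (x : ℝ) :
    (bipartiteMatrix A).charpoly.eval x =
      ∑ i ∈ range (N + 1), minorSum (-bipartiteMatrix A) i i * x ^ (M + N - (i + i)) := by
  rw [Matrix.eval_charpoly, sub_eq_add_neg, Matrix.scalar_apply, det_diagonal_add,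
    sum_finset_sumType, ← sum_prinMinor_mul _ hNM (minorSum_neg_bipartite A)
      fun i j => x ^ (M + N - (i + j))]
  simp [card_compl]

/-- Minors of the negated matrix are the coefficients themselves, so no signs appear. The exponents
match through `M + N - 2 * i = (M - N) + 2 * (N - i)`. -/
theorem minorSum_eq_coeff (A : Matrix (Fin M) (Fin N) ℝ) (hNM : N ≤ M) (p : ℝ[X])
    (hp : (bipartiteMatrix A).charpoly = X ^ (M - N) * squareSubst p) {i : ℕ} (hi : i ≤ N) :
    minorSum (-bipartiteMatrix A) i i = p.coeff (N - i) := by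
  have h1 : (bipartiteMatrix A).charpoly = ∑ j ∈ range (N + 1),
      C (minorSum (-bipartiteMatrix A) j j) * X ^ (M + N - (j + j)) := by
    apply Polynomial.funext
    intro x
    rw [eval_charpoly_bipartite A hNM]
    simp [Polynomial.eval_finsetSum]
  have h2 := congrArg (fun q => Polynomial.coeff q (M + N - (i + i))) (h1.symm.trans hp)
  simp only [Polynomial.finsetSum_coeff, Polynomial.coeff_C_mul, Polynomial.coeff_X_pow] at h2
  rw [Finset.sum_eq_single i] at h2
  · rw [if_pos rfl, mul_one] at h2
    rw [h2, squareSubst, ← Polynomial.expand_eq_comp_X_pow,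
      show M + N - (i + i) = (N - i) * 2 + (M - N) by omega, Polynomial.coeff_X_pow_mul,
      Polynomial.coeff_expand_mul two_pos]
  · intro j hj hji
    rw [if_neg, mul_zero]
    simp at hj
    omega
  · intro h
    simp at h
    omega

theorem eval_squareSubst_rectConv (hNM : N ≤ M) (p q : ℝ[X]) (x : ℝ) :
    (X ^ (M - N) * squareSubst (rectConv M N p q)).eval x =
      ∑ i ∈ range (N + 1), ∑ j ∈ range (N - i + 1),
        p.coeff (N - i) * q.coeff (N - j) * ((M - i).choose j / M.choose j) *
          ((N - i).choose j / N.choose j) * x ^ (M + N - (i + i) - (j + j)) := by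
  have h1 : ∀ i ∈ range (N + 1), N - i + 1 = N + 1 - i := by
    intro i hi
    simp at hi
    omega
  rw [Finset.sum_congr rfl fun i hi => by rw [h1 i hi], ← Finset.sum_range_diag_flip (N + 1)
    fun i j => p.coeff (N - i) * q.coeff (N - j) * ((M - i).choose j / M.choose j) *
          ((N - i).choose j / N.choose j) * x ^ (M + N - (i + i) - (j + j))]
  rw [squareSubst, rectConv, Polynomial.eval_mul, Polynomial.eval_comp, Polynomial.eval_finsetSum,
    Finset.mul_sum]
  refine Finset.sum_congr rfl fun l hl => ?_
  have hl' : l ≤ N := by simp at hl; omega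
  rw [← Finset.Nat.sum_antidiagonal_eq_sum_range_succ fun i j => p.coeff (N - i) *
    q.coeff (N - j) * (((M - i).choose j : ℝ) / M.choose j) *
          (((N - i).choose j : ℝ) / N.choose j) * x ^ (M + N - (i + i) - (j + j))]
  simp only [Polynomial.eval_mul, Polynomial.eval_pow, Polynomial.eval_X, Polynomial.eval_C]
  rw [Finset.mul_sum, Finset.sum_mul, Finset.mul_sum]
  refine Finset.sum_congr rfl fun ij hij => ?_
  have hij' : ij.1 + ij.2 = l := by simpa using hij
  rw [choose_ratio (M := M) (by omega), choose_ratio (M := N) (by omega), hij', signedCoeff,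
    signedCoeff, show M + N - (ij.1 + ij.1) - (ij.2 + ij.2) = (M - N) + 2 * (N - l) by omega,
    pow_add x, pow_mul x]
  -- The outer sign of `rectConv` cancels the two signs in `signedCoeff`, since `l` is the sum of
  -- the two indices.
  have hs : (-1 : ℝ) ^ l * (-1) ^ ij.1 * (-1) ^ ij.2 = 1 := by
    rw [mul_assoc, ← pow_add, hij', ← pow_add]
    exact Even.neg_one_pow (by simp)
  linear_combination (((N - ij.1).factorial * (N - ij.2).factorial : ℝ) /
    (N.factorial * (N - l).factorial)) * (((M - ij.1).factorial * (M - ij.2).factorial : ℝ) /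
    (M.factorial * (M - l).factorial)) * p.coeff (N - ij.1) * q.coeff (N - ij.2) *
      x ^ (M - N) * (x ^ 2) ^ (N - l) * hs

/-- The rectangular additive convolution is the average over signed permutations. -/
theorem sum_signedPerm_charpoly (hNM : N ≤ M) (A B : Matrix (Fin M) (Fin N) ℝ) (p q : ℝ[X])
    (hp : (bipartiteMatrix A).charpoly = X ^ (M - N) * squareSubst p)
    (hq : (bipartiteMatrix B).charpoly = X ^ (M - N) * squareSubst q) :
    (∑ σ : Equiv.Perm (Fin M), ∑ τ : Equiv.Perm (Fin N), ∑ ε : Fin M ⊕ Fin N → ℤˣ,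
      (bipartiteMatrix (A + Matrix.of fun a b =>
        (((ε (.inl a) * ε (.inr b) : ℤˣ) : ℤ) : ℝ) * B (σ a) (τ b))).charpoly) =
      C (2 ^ (M + N) * (M.factorial * N.factorial) : ℝ) *
        (X ^ (M - N) * squareSubst (rectConv M N p q)) := by
  apply Polynomial.funext
  intro x
  have h1 : ∀ (σ : Equiv.Perm (Fin M)) (τ : Equiv.Perm (Fin N)) (ε : Fin M ⊕ Fin N → ℤˣ),
      (bipartiteMatrix (A + Matrix.of fun a b =>
        (((ε (.inl a) * ε (.inr b) : ℤˣ) : ℤ) : ℝ) * B (σ a) (τ b))).charpoly.eval x =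
      ((Matrix.diagonal (fun _ => x) + -bipartiteMatrix A) +
        Matrix.of fun a b => (((ε a * ε b : ℤˣ) : ℤ) : ℝ) *
          ((-bipartiteMatrix B).submatrix (Sum.map σ τ) (Sum.map σ τ)) a b).det := by
    intro σ τ ε
    rw [Matrix.eval_charpoly]
    congr 1
    ext (a | a) (b | b) <;> simp [bipartiteMatrix]
    · ring
    · ring
  simp only [Polynomial.eval_finsetSum, h1, sum_signs_det]
  rw [Polynomial.eval_mul, Polynomial.eval_C, eval_squareSubst_rectConv hNM]
  simp_rw [← Finset.mul_sum]
  rw [Fintype.card_sum, Fintype.card_fin, Fintype.card_fin, mul_assoc]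
  congr 1
  simp_rw [sum_finset_sumType]
  have h2 : ∀ (K : Finset (Fin M)) (L : Finset (Fin N)),
      prinMinor (Matrix.diagonal (fun _ => x) + -bipartiteMatrix A) (K.disjSum L)ᶜ =
        ∑ K' ∈ Kᶜ.powerset, ∑ L' ∈ Lᶜ.powerset, prinMinor (-bipartiteMatrix A) (K'.disjSum L') *
          x ^ (M + N - (K'.card + L'.card) - (K.card + L.card)) := by
    intro K L
    rw [prinMinor_diagonal_add]
    have hfilter : ∀ f : Finset (Fin M ⊕ Fin N) → ℝ, ∑ I ∈ (K.disjSum L)ᶜ.powerset, f I =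
        ∑ K' ∈ Kᶜ.powerset, ∑ L' ∈ Lᶜ.powerset, f (K'.disjSum L') := by
      intro f
      have e1 : (K.disjSum L)ᶜ.powerset =
          (univ : Finset (Finset (Fin M ⊕ Fin N))).filter (· ⊆ (K.disjSum L)ᶜ) := by ext; simp
      have e2 : Kᶜ.powerset = (univ : Finset (Finset (Fin M))).filter (· ⊆ Kᶜ) := by ext; simp
      have e3 : Lᶜ.powerset = (univ : Finset (Finset (Fin N))).filter (· ⊆ Lᶜ) := by ext; simp
      rw [e1, e2, e3, Finset.sum_filter, sum_finset_sumType, Finset.sum_filter]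
      refine Finset.sum_congr rfl fun K' _ => ?_
      rw [Finset.sum_filter]
      have hsub : ∀ L' : Finset (Fin N),
          K'.disjSum L' ⊆ (K.disjSum L)ᶜ ↔ K' ⊆ Kᶜ ∧ L' ⊆ Lᶜ := by
        intro L'
        simp [Finset.subset_iff]
      split_ifs with h
      · exact Finset.sum_congr rfl fun L' _ => by simp [hsub, h]
      · exact Finset.sum_eq_zero fun L' _ => by simp [hsub, h]
    rw [hfilter]
    refine Finset.sum_congr rfl fun K' hK' => Finset.sum_congr rfl fun L' hL' => ?_
    rw [Finset.prod_const, Finset.card_sdiff_of_subset]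
    · simp only [card_compl, Fintype.card_sum, Fintype.card_fin, card_disjSum]
      congr 2
      omega
    · intro x hx
      rw [Finset.mem_powerset] at hK' hL'
      rcases x with x | x
      · have := hK' (by simpa using hx : x ∈ K')
        simpa using this
      · have := hL' (by simpa using hx : x ∈ L')
        simpa using this
  have h3 : (∑ σ : Equiv.Perm (Fin M), ∑ τ : Equiv.Perm (Fin N), ∑ K : Finset (Fin M),
      ∑ L : Finset (Fin N),
      prinMinor ((-bipartiteMatrix B).submatrix (Sum.map σ τ) (Sum.map σ τ)) (K.disjSum L) *
        prinMinor (Matrix.diagonal (fun _ => x) + -bipartiteMatrix A) (K.disjSum L)ᶜ) =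
      ∑ K : Finset (Fin M), ∑ L : Finset (Fin N),
        (M.factorial * N.factorial / (M.choose K.card * N.choose L.card) *
        minorSum (-bipartiteMatrix B) K.card L.card) *
        prinMinor (Matrix.diagonal (fun _ => x) + -bipartiteMatrix A) (K.disjSum L)ᶜ := by
    simp_rw [← sum_sum_perm_prinMinor, Finset.sum_mul]
    rw [Finset.sum_congr rfl fun σ _ => Finset.sum_comm]
    rw [Finset.sum_comm]
    refine Finset.sum_congr rfl fun K _ => ?_
    rw [Finset.sum_congr rfl fun σ _ => Finset.sum_comm]
    rw [Finset.sum_comm]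
  rw [h3]
  simp_rw [h2, Finset.mul_sum]
  -- Disjointness of the index sets is symmetric, so the minor of `A` can be fixed first. The
  -- summands for `B` then depend only on the sizes of the sets disjoint from it.
  have hswap : ∀ f : Finset (Fin M) → Finset (Fin N) → Finset (Fin M) → Finset (Fin N) → ℝ,
      (∑ K, ∑ L, ∑ K' ∈ Kᶜ.powerset, ∑ L' ∈ Lᶜ.powerset, f K L K' L') =
        ∑ K', ∑ L', ∑ K ∈ K'ᶜ.powerset, ∑ L ∈ L'ᶜ.powerset, f K L K' L' := by
    intro f
    have e1 : ∀ K : Finset (Fin M), (∑ L : Finset (Fin N), ∑ K' ∈ Kᶜ.powerset,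
        ∑ L' ∈ Lᶜ.powerset, f K L K' L') = ∑ K' ∈ Kᶜ.powerset, ∑ L' : Finset (Fin N),
        ∑ L ∈ L'ᶜ.powerset, f K L K' L' := by
      intro K
      rw [Finset.sum_comm]
      refine Finset.sum_congr rfl fun K' _ => Finset.sum_comm' fun L L' => ?_
      simp [Finset.subset_compl_comm]
    simp_rw [e1]
    rw [Finset.sum_comm' (t' := univ) (s' := fun K' => K'ᶜ.powerset)
      (by intro K K'; simp [Finset.subset_compl_comm])]
    exact Finset.sum_congr rfl fun K' _ => Finset.sum_comm
  rw [hswap]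
  set g : ℕ → ℕ → ℕ → ℕ → ℝ := fun k l i j =>
    M.factorial * N.factorial / (M.choose i * N.choose j) *
      minorSum (-bipartiteMatrix B) i j * x ^ (M + N - (k + l) - (i + j)) with hg
  have h4 : ∀ (K' : Finset (Fin M)) (L' : Finset (Fin N)),
      (∑ K ∈ K'ᶜ.powerset, ∑ L ∈ L'ᶜ.powerset,
        M.factorial * N.factorial / (M.choose K.card * N.choose L.card) *
          minorSum (-bipartiteMatrix B) K.card L.card *
          (prinMinor (-bipartiteMatrix A) (K'.disjSum L') *
            x ^ (M + N - (K'.card + L'.card) - (K.card + L.card)))) =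
      prinMinor (-bipartiteMatrix A) (K'.disjSum L') * ∑ j ∈ range (N - L'.card + 1),
        ((M - K'.card).choose j * (N - L'.card).choose j : ℝ) * g K'.card L'.card j j := by
    intro K' L'
    by_cases h : K'.card = L'.card
    · rw [← sum_powerset_card_diag K' L' hNM h (g K'.card L'.card)]
      · simp_rw [Finset.mul_sum]
        refine Finset.sum_congr rfl fun K _ => Finset.sum_congr rfl fun L _ => ?_
        simp only [hg]
        ring
      · intro i j hij
        simp [hg, minorSum_neg_bipartite B i j hij]
    · simp [prinMinor_neg_bipartite A K' L' h]
  simp_rw [h4]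
  rw [sum_prinMinor_mul _ hNM (minorSum_neg_bipartite A) fun k l => ∑ j ∈ range (N - l + 1),
        ((M - k).choose j * (N - l).choose j : ℝ) * g k l j j]
  refine Finset.sum_congr rfl fun i hi => ?_
  have hi' : i ≤ N := by simp at hi; omega
  rw [Finset.mul_sum]
  refine Finset.sum_congr rfl fun j hj => ?_
  have hj' : j ≤ N := by simp at hj; omega
  rw [minorSum_eq_coeff A hNM p hp hi']
  simp only [hg]
  rw [minorSum_eq_coeff B hNM q hq hj']
  ring

end PermutationAverage

/-! ### Characteristic polynomials of bipartite matrices -/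

section BipartiteCharpoly

open Matrix

variable {m n : ℕ}

/-- For `x ≠ 0` the block `x • 1` is invertible and its Schur complement is `x⁻¹` times the
characteristic matrix of the Gram matrix at `x ^ 2`. Infinitely many points determine the
polynomial. -/
theorem charpoly_bipartite (A : Matrix (Fin m) (Fin n) ℝ) (hnm : n ≤ m) :
    (bipartiteMatrix A).charpoly = X ^ (m - n) * squareSubst (A.transpose * A).charpoly := by
  apply Polynomial.eq_of_infinite_eval_eq
  refine Set.Infinite.mono (s := {x : ℝ | x ≠ 0}) ?_ (Set.Finite.infinite_compl (Set.finite_singleton 0))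
  intro x (hx : x ≠ 0)
  simp only [Set.mem_ofPred_eq]
  have h1 : Matrix.scalar (Fin m ⊕ Fin n) x - bipartiteMatrix A =
      Matrix.fromBlocks (x • 1) (-A) (-A.transpose) (x • 1) := by
    ext (a | a) (b | b) <;> simp [bipartiteMatrix, Matrix.diagonal_apply, Matrix.one_apply]
  let _ : Invertible (x • (1 : Matrix (Fin m) (Fin m) ℝ)) :=
    ⟨x⁻¹ • (1 : Matrix (Fin m) (Fin m) ℝ), by simp [smul_smul, hx], by simp [smul_smul, hx]⟩
  have hinv : ⅟(x • (1 : Matrix (Fin m) (Fin m) ℝ)) =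
    x⁻¹ • (1 : Matrix (Fin m) (Fin m) ℝ) := rfl
  have h2 : x • (1 : Matrix (Fin n) (Fin n) ℝ) - -A.transpose * (x⁻¹ • (1 : Matrix (Fin m) (Fin m) ℝ)) * -A =
      x⁻¹ • (Matrix.scalar (Fin n) (x ^ 2) - A.transpose * A) := by
    rw [smul_sub, Matrix.scalar_apply, ← Matrix.smul_one_eq_diagonal, smul_smul]
    congr 1
    · congr 1
      field_simp
    · simp
  rw [Matrix.eval_charpoly, h1, Matrix.det_fromBlocks₁₁, hinv, h2, Matrix.det_smul, Matrix.det_smul,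
    Matrix.det_one, squareSubst, Polynomial.eval_mul, Polynomial.eval_comp, Matrix.eval_charpoly,
    Fintype.card_fin, Fintype.card_fin]
  simp only [Polynomial.eval_pow, Polynomial.eval_X, mul_one]
  rw [← mul_assoc, inv_pow, ← pow_sub₀ x hx hnm]

theorem charpoly_bipartite_transpose (A : Matrix (Fin m) (Fin n) ℝ) :
    (bipartiteMatrix A.transpose).charpoly = (bipartiteMatrix A).charpoly := by
  rw [← Matrix.charpoly_reindex (Equiv.sumComm (Fin n) (Fin m))]
  congr 1
  ext (a | a) (b | b) <;> simp [bipartiteMatrix]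

theorem charpoly_bipartite_submatrix (A : Matrix (Fin m) (Fin n) ℝ) (σ : Equiv.Perm (Fin m))
    (τ : Equiv.Perm (Fin n)) :
    (bipartiteMatrix (A.submatrix σ τ)).charpoly = (bipartiteMatrix A).charpoly := by
  rw [← Matrix.charpoly_reindex (Equiv.sumCongr σ.symm τ.symm) (bipartiteMatrix A)]
  congr 1
  ext (a | a) (b | b) <;> simp [bipartiteMatrix]

end BipartiteCharpoly

/-! ### Determinants of rank-two pencils and cube roots of unity -/

section RankTwoPencil

open Matrix

variable {κ R : Type*} [Fintype κ] [DecidableEq κ] [CommRing R]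

/-- The determinant is affine in `d`: after bordering `K` by the column `u`, the coefficient enters
only one row, and the determinant is linear in that row. -/
theorem det_add_smul_vecMulVec (K : Matrix κ κ R) (u v : κ → R) (d : R) :
    (K + d • vecMulVec u v).det = (1 - d) * K.det + d * (K + vecMulVec u v).det := by
  have key : ∀ e : R, (K + e • vecMulVec u v).det =
      (Matrix.fromBlocks K (Matrix.of fun i (_ : Unit) => u i)
        (Matrix.of fun (_ : Unit) j => -e * v j) 1).det := by
    intro e
    rw [Matrix.det_fromBlocks_one₂₂]
    congr 1
    ext i j
    simp [Matrix.mul_apply, vecMulVec_apply]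
    ring
  have hrow : ∀ e : R, (Matrix.fromBlocks K (Matrix.of fun i (_ : Unit) => u i)
        (Matrix.of fun (_ : Unit) j => -e * v j) 1) =
      Matrix.updateRow (Matrix.fromBlocks K (Matrix.of fun i (_ : Unit) => u i) 0 1) (Sum.inr ())
        (Sum.elim (0 : κ → R) (fun _ : Unit => 1) + e • Sum.elim (-v) (fun _ : Unit => 0)) := by
    intro e
    ext (a | a) (b | b) <;> simp [Matrix.updateRow_apply]
  have h0 := key 0
  have h1 := key 1
  have hd := key d
  rw [hrow, Matrix.det_updateRow_add, Matrix.det_updateRow_smul] at h0 h1 hd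
  rw [zero_smul, add_zero] at h0
  rw [one_smul] at h1
  rw [hd, h1, h0]
  ring

/-- Each parameter multiplies two rank-one terms, and the determinant is affine in the coefficient
of each; hence degree at most two per parameter. -/
theorem exists_det_pencil (K : Matrix κ κ R) (u v u' v' : κ → R) :
    ∃ c : Fin 3 → Fin 3 → R, ∀ z z' : R,
      (K + z • (vecMulVec u v + vecMulVec v u) + z' • (vecMulVec u' v' + vecMulVec v' u')).det =
        ∑ a, ∑ b, c a b * z ^ (a : ℕ) * z' ^ (b : ℕ) := by
  have hrank : ∀ (L : Matrix κ κ R) (u v : κ → R), ∀ z : R,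
      (L + z • (vecMulVec u v + vecMulVec v u)).det = L.det +
        z * ((L + vecMulVec u v).det + (L + vecMulVec v u).det - 2 * L.det) +
        z ^ 2 * (L.det - (L + vecMulVec u v).det - (L + vecMulVec v u).det +
          (L + vecMulVec u v + vecMulVec v u).det) := by
    intro L u v z
    rw [smul_add, ← add_assoc, det_add_smul_vecMulVec, det_add_smul_vecMulVec,
      add_right_comm L, det_add_smul_vecMulVec, add_right_comm L]
    ring
  choose c0 c1 c2 hc using fun L : Matrix κ κ R =>
    (⟨_, _, _, hrank L u v⟩ : ∃ c0 c1 c2 : R, ∀ z : R,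
      (L + z • (vecMulVec u v + vecMulVec v u)).det = c0 + z * c1 + z ^ 2 * c2)
  have hswap : ∀ z z' : R,
      (K + z • (vecMulVec u v + vecMulVec v u) + z' • (vecMulVec u' v' + vecMulVec v' u')).det =
        c0 K + z * c1 K + z ^ 2 * c2 K +
        z' * ((c0 (K + vecMulVec u' v') + z * c1 (K + vecMulVec u' v') +
          z ^ 2 * c2 (K + vecMulVec u' v')) + (c0 (K + vecMulVec v' u') +
          z * c1 (K + vecMulVec v' u') + z ^ 2 * c2 (K + vecMulVec v' u')) -
          2 * (c0 K + z * c1 K + z ^ 2 * c2 K)) +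
        z' ^ 2 * ((c0 K + z * c1 K + z ^ 2 * c2 K) - (c0 (K + vecMulVec u' v') +
          z * c1 (K + vecMulVec u' v') + z ^ 2 * c2 (K + vecMulVec u' v')) -
          (c0 (K + vecMulVec v' u') + z * c1 (K + vecMulVec v' u') +
          z ^ 2 * c2 (K + vecMulVec v' u')) + (c0 (K + vecMulVec u' v' + vecMulVec v' u') +
          z * c1 (K + vecMulVec u' v' + vecMulVec v' u') +
          z ^ 2 * c2 (K + vecMulVec u' v' + vecMulVec v' u'))) := by
    intro z z'
    rw [hrank]
    simp only [← hc, add_right_comm K]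
    congr 4
    rw [add_right_comm K, add_right_comm (K + _)]
  refine ⟨fun a b => ![![c0 K, c0 (K + vecMulVec u' v') + c0 (K + vecMulVec v' u') - 2 * c0 K,
      c0 K - c0 (K + vecMulVec u' v') - c0 (K + vecMulVec v' u') +
        c0 (K + vecMulVec u' v' + vecMulVec v' u')],
    ![c1 K, c1 (K + vecMulVec u' v') + c1 (K + vecMulVec v' u') - 2 * c1 K,
      c1 K - c1 (K + vecMulVec u' v') - c1 (K + vecMulVec v' u') +
        c1 (K + vecMulVec u' v' + vecMulVec v' u')],
    ![c2 K, c2 (K + vecMulVec u' v') + c2 (K + vecMulVec v' u') - 2 * c2 K,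
      c2 K - c2 (K + vecMulVec u' v') - c2 (K + vecMulVec v' u') +
        c2 (K + vecMulVec u' v' + vecMulVec v' u')]] a b, fun z z' => ?_⟩
  rw [hswap]
  simp [Fin.sum_univ_three]
  ring

/-- Averaging a rank-two pencil over the cube roots of unity depends only on the product of the
two parameters. -/
theorem sum_cubeRoots_det_pencil (K : Matrix κ κ R) (u v u' v' : κ → R) {ω : R}
    (hω : 1 + ω + ω ^ 2 = 0) {z z' y y' : R} (h : z * z' = y * y') :
    (∑ k : Fin 3, (K + (ω ^ (k : ℕ) * z) • (vecMulVec u v + vecMulVec v u) +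
      ((ω ^ 2) ^ (k : ℕ) * z') • (vecMulVec u' v' + vecMulVec v' u')).det) =
    ∑ k : Fin 3, (K + (ω ^ (k : ℕ) * y) • (vecMulVec u v + vecMulVec v u) +
      ((ω ^ 2) ^ (k : ℕ) * y') • (vecMulVec u' v' + vecMulVec v' u')).det := by
  obtain ⟨c, hc⟩ := exists_det_pencil K u v u' v'
  have hω2 : ω ^ 2 = -1 - ω := by linear_combination hω
  have hω3 : ω ^ 3 = 1 := by linear_combination (ω - 1) * hω
  -- The term in `z ^ a * z' ^ b` is multiplied by the sum of the powers of `ω ^ (a + 2 * b)`, which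
  -- vanishes unless `a ≡ b` modulo 3. As `a` and `b` are at most 2, only `a = b` survives.
  have hsum : ∀ z z' : R, (∑ k : Fin 3, (K + (ω ^ (k : ℕ) * z) • (vecMulVec u v + vecMulVec v u) +
      ((ω ^ 2) ^ (k : ℕ) * z') • (vecMulVec u' v' + vecMulVec v' u')).det) =
      3 * (c 0 0 + c 1 1 * (z * z') + c 2 2 * (z * z') ^ 2) := by
    intro z z'
    have h0 : (ω : R) ^ 4 = ω := by linear_combination ω * hω3
    have h8 : (ω : R) ^ 8 = ω ^ 2 := by linear_combination (ω ^ 5 + ω ^ 2) * hω3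
    simp only [hc, Fin.sum_univ_three, Fin.val_zero, Fin.val_one, Fin.val_two, pow_zero, pow_one,
      mul_one, one_mul, ← pow_mul]
    norm_num [mul_pow, ← pow_mul]
    simp only [h0, h8, hω2]
    ring_nf
    simp only [hω2]
    ring
  rw [hsum, hsum, h]

end RankTwoPencil

/-! ### Reflections and invariance of the row-permutation average -/

section Householder

open Matrix

/-- The Householder reflection along `v`. -/
def householder {ι : Type*} [Fintype ι] [DecidableEq ι] (v : ι → ℝ) : Matrix ι ι ℝ :=
  1 - (2 / (v ⬝ᵥ v)) • vecMulVec v v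

theorem householder_mul_self {ι : Type*} [Fintype ι] [DecidableEq ι] (v : ι → ℝ) :
    householder v * householder v = 1 := by
  -- Division by zero gives `2 / 0 = 0`, so the reflection along the zero vector is the identity.
  by_cases hv : v ⬝ᵥ v = 0
  · simp [householder, hv]
  · have : vecMulVec v v * vecMulVec v v = (v ⬝ᵥ v) • vecMulVec v v := by
      rw [vecMulVec_mul_vecMulVec]
      simp [vecMulVec_smul]
    simp only [householder, mul_sub, sub_mul, mul_one, one_mul, smul_mul_smul_comm, this, smul_smul]
    have h2 : 2 / (v ⬝ᵥ v) * (2 / (v ⬝ᵥ v)) * (v ⬝ᵥ v) = 2 / (v ⬝ᵥ v) + 2 / (v ⬝ᵥ v) := by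
      field_simp
      norm_num
    rw [h2, add_smul]
    abel

theorem householder_transpose {ι : Type*} [Fintype ι] [DecidableEq ι] (v : ι → ℝ) :
    (householder v)ᵀ = householder v := by
  simp [householder, transpose_vecMulVec]

/-- Vectors of equal length are mirror images in the hyperplane orthogonal to their difference. -/
theorem householder_sub_mulVec {ι : Type*} [Fintype ι] [DecidableEq ι] (v w : ι → ℝ)
    (h : v ⬝ᵥ v = w ⬝ᵥ w) : householder (v - w) *ᵥ w = v := by
  by_cases hd : v = w
  · subst hd
    simp [householder]
  have hd' : (v - w) ⬝ᵥ (v - w) ≠ 0 := by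
    rw [Ne, dotProduct_self_eq_zero, sub_eq_zero]
    exact hd
  have hdd : (v - w) ⬝ᵥ (v - w) = 2 * (w ⬝ᵥ w - v ⬝ᵥ w) := by
    simp only [sub_dotProduct, dotProduct_sub, h, dotProduct_comm w v]
    ring
  rw [householder, sub_mulVec, one_mulVec, smul_mulVec, vecMulVec_mulVec]
  have hc : (v - w) ⬝ᵥ w = - ((v - w) ⬝ᵥ (v - w)) / 2 := by
    rw [hdd, sub_dotProduct]; ring
  rw [hc]
  generalize (v - w) ⬝ᵥ (v - w) = D at hd'
  ext i
  simp only [Pi.sub_apply, Pi.smul_apply, smul_eq_mul, MulOpposite.smul_eq_mul_unop,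
    MulOpposite.unop_op]
  field_simp
  ring

theorem householder_conj {ι : Type*} [Fintype ι] [DecidableEq ι] (v w : ι → ℝ)
    (h : v ⬝ᵥ v = w ⬝ᵥ w) :
    householder (v - w) * householder w * householder (v - w) = householder v := by
  have hw := householder_sub_mulVec v w h
  have hw' : w ᵥ* householder (v - w) = v := by
    rw [← mulVec_transpose, householder_transpose, hw]
  conv_lhs => rw [householder.eq_1 w]
  rw [mul_sub, sub_mul, mul_one, householder_mul_self, mul_smul_comm, smul_mul_assoc,
    mul_vecMulVec, vecMulVec_mul, hw, hw', ← h, householder]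

variable {m : ℕ}

/-- Left multiplication of one summand by `Q` does not change the average of the characteristic
polynomial over all row permutations. -/
def RowInvariant (Q : Matrix (Fin m) (Fin m) ℝ) : Prop :=
  ∀ (n : ℕ) (A B : Matrix (Fin m) (Fin n) ℝ),
    (∑ σ : Equiv.Perm (Fin m), (bipartiteMatrix (A + (Q * B).submatrix σ id)).charpoly) =
      ∑ σ : Equiv.Perm (Fin m), (bipartiteMatrix (A + B.submatrix σ id)).charpoly

theorem RowInvariant.one : RowInvariant (1 : Matrix (Fin m) (Fin m) ℝ) := by
  intro n A B
  rw [Matrix.one_mul]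

theorem RowInvariant.mul {P Q : Matrix (Fin m) (Fin m) ℝ} (hP : RowInvariant P)
    (hQ : RowInvariant Q) : RowInvariant (P * Q) := by
  intro n A B
  rw [Matrix.mul_assoc, hP, hQ]

theorem rowInvariant_perm {Q : Matrix (Fin m) (Fin m) ℝ} (ρ : Equiv.Perm (Fin m))
    (hQ : Q = (1 : Matrix (Fin m) (Fin m) ℝ).submatrix ρ id) : RowInvariant Q := by
  intro n A B
  have : Q * B = B.submatrix ρ id := by
    rw [hQ]
    ext a b
    simp [Matrix.mul_apply, Matrix.one_apply]
  rw [this]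
  exact Equiv.sum_comp (Equiv.mulLeft ρ) fun σ =>
    (bipartiteMatrix (A + B.submatrix σ id)).charpoly

theorem householder_single_sub {i j : Fin m} (hij : i ≠ j) {c : ℝ} (hc : c ≠ 0) :
    householder (Pi.single i c - Pi.single j c) =
      (1 : Matrix (Fin m) (Fin m) ℝ).submatrix (Equiv.swap i j) id := by
  have hd : (Pi.single i c - Pi.single j c : Fin m → ℝ) ⬝ᵥ (Pi.single i c - Pi.single j c) =
      2 * c ^ 2 := by
    simp [hij, hij.symm]
    ring
  ext a b
  simp only [householder, hd, Matrix.sub_apply, Matrix.smul_apply, vecMulVec_apply, Pi.sub_apply, submatrix_apply,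
    id, one_apply, Pi.single_apply, Equiv.swap_apply_def, smul_eq_mul]
  have hji := hij.symm
  have h3 : 2 / (2 * c ^ 2) * (c * c) = 1 := by field_simp
  by_cases hai : a = i <;> by_cases haj : a = j <;> by_cases hbi : b = i <;>
    by_cases hbj : b = j <;> by_cases hab : a = b <;> simp_all
  all_goals try grind

end Householder

/-! ### Reflections supported on three coordinates -/

section TriangleQuadrature

open Matrix

variable {m : ℕ}

/-- The vector with entries `1, ω, ω²` at `i, j, k` and zero elsewhere. -/
def cubeVec (ω : ℂ) (i j k : Fin m) : Fin m → ℂ := fun a =>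
  if a = i then 1 else if a = j then ω else if a = k then ω ^ 2 else 0

/-- The orthogonal projection that averages over `i, j, k` and fixes the other coordinates. -/
def triangleMean (i j k : Fin m) : Matrix (Fin m) (Fin m) ℂ := Matrix.of fun a b =>
  if a = i ∨ a = j ∨ a = k then (if b = i ∨ b = j ∨ b = k then 1 / 3 else 0) else
    if a = b then 1 else 0

/-- The three-cycle `i → j → k → i`. -/
def threeCycle (i j k : Fin m) : Equiv.Perm (Fin m) := Equiv.swap i j * Equiv.swap j k

variable {i j k : Fin m}

theorem threeCycle_fst (hij : i ≠ j) (hik : i ≠ k) : threeCycle i j k i = j := by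
  simp [threeCycle, Equiv.swap_apply_of_ne_of_ne hij hik]

theorem threeCycle_snd (hik : i ≠ k) (hjk : j ≠ k) : threeCycle i j k j = k := by
  simp [threeCycle, Equiv.swap_apply_of_ne_of_ne hik.symm hjk.symm]

theorem threeCycle_thd : threeCycle i j k k = i := by
  simp [threeCycle]

theorem threeCycle_of_ne {a : Fin m} (hi : a ≠ i) (hj : a ≠ j) (hk : a ≠ k) :
    threeCycle i j k a = a := by
  simp [threeCycle, Equiv.swap_apply_of_ne_of_ne hj hk, Equiv.swap_apply_of_ne_of_ne hi hj]

theorem cubeVec_threeCycle (hij : i ≠ j) (hik : i ≠ k) (hjk : j ≠ k) {ω : ℂ} (hω : ω ^ 3 = 1)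
    (a : Fin m) : cubeVec ω i j k (threeCycle i j k a) = ω * cubeVec ω i j k a := by
  by_cases hi : a = i
  · subst hi; rw [threeCycle_fst hij hik]; simp [cubeVec, hij.symm]
  by_cases hj : a = j
  · subst hj; rw [threeCycle_snd hik hjk]; simp [cubeVec, hik.symm, hjk.symm, hij.symm, pow_two]
  by_cases hk : a = k
  · subst hk
    rw [threeCycle_thd]
    simp only [cubeVec, if_true, hi, hj, if_false]
    linear_combination -hω
  · rw [threeCycle_of_ne hi hj hk]; simp [cubeVec, hi, hj, hk]

theorem triangleMean_threeCycle (hij : i ≠ j) (hik : i ≠ k) (hjk : j ≠ k) (a b : Fin m) :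
    triangleMean i j k (threeCycle i j k a) b = triangleMean i j k a b := by
  by_cases hi : a = i
  · subst hi; rw [threeCycle_fst hij hik]; simp [triangleMean]
  by_cases hj : a = j
  · subst hj; rw [threeCycle_snd hik hjk]; simp [triangleMean]
  by_cases hk : a = k
  · subst hk; rw [threeCycle_thd]; simp [triangleMean]
  · rw [threeCycle_of_ne hi hj hk]

theorem exists_reflection_params {ω : ℂ} (hω : 1 + ω + ω ^ 2 = 0) {p q r : ℝ}
    (hs : p + q + r = 0) (hS : p ^ 2 + q ^ 2 + r ^ 2 ≠ 0) :
    ∃ z z' : ℂ, z * z' = 1 / 9 ∧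
      1 - 2 / ((p : ℂ) ^ 2 + q ^ 2 + r ^ 2) * (p * p) = 1 / 3 + z + z' ∧
      1 - 2 / ((p : ℂ) ^ 2 + q ^ 2 + r ^ 2) * (q * q) = 1 / 3 + z * ω ^ 2 + z' * ω ∧
      1 - 2 / ((p : ℂ) ^ 2 + q ^ 2 + r ^ 2) * (r * r) = 1 / 3 + z * ω + z' * ω ^ 2 ∧
      - (2 / ((p : ℂ) ^ 2 + q ^ 2 + r ^ 2) * (p * q)) = 1 / 3 + z * ω + z' * ω ^ 2 ∧
      - (2 / ((p : ℂ) ^ 2 + q ^ 2 + r ^ 2) * (p * r)) = 1 / 3 + z * ω ^ 2 + z' * ω ∧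
      - (2 / ((p : ℂ) ^ 2 + q ^ 2 + r ^ 2) * (q * r)) = 1 / 3 + z + z' := by
  have hω2 : ω ^ 2 = -1 - ω := by linear_combination hω
  have hS' : (p : ℂ) ^ 2 + q ^ 2 + r ^ 2 ≠ 0 := by exact_mod_cast hS
  have hr : (r : ℂ) = -p - q := by
    have : r = -p - q := by linarith
    rw [this]; push_cast; ring
  have hSe : (p : ℂ) ^ 2 + q ^ 2 + r ^ 2 = 2 * (p ^ 2 + p * q + q ^ 2) := by rw [hr]; ring
  generalize (p : ℂ) ^ 2 + q ^ 2 + r ^ 2 = S at *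
  generalize (r : ℂ) = r' at *
  subst hr
  -- With `S = p² + q² + r²`, these are `-(2/9) (p + q ω² + r ω)² / S` and `-(2/9) (p + q ω + r ω²)²
  -- / S`, reduced by `r = -p - q` and `ω² = -1 - ω`: the squared components of the vector along the
  -- two isotropic lines.
  refine ⟨-(2 / 9) * ((p - q) ^ 2 - (p + 2 * q) ^ 2 +
      (-2 * (p - q) * (p + 2 * q) - (p + 2 * q) ^ 2) * ω) / S,
    -(2 / 9) * ((2 * p + q) ^ 2 - (p + 2 * q) ^ 2 +
      (2 * (2 * p + q) * (p + 2 * q) - (p + 2 * q) ^ 2) * ω) / S,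
    ?_, ?_, ?_, ?_, ?_, ?_, ?_⟩ <;> field_simp <;> rw [hSe] <;> grind

/-- The two cube vectors span the complexified sum-zero plane and are isotropic with pairing 3. A
reflection of the plane exchanges their lines, and being an involution it satisfies `9 * z * z' =
1`. -/
theorem householder_eq_triangle (hij : i ≠ j) (hik : i ≠ k) (hjk : j ≠ k) {ω : ℂ}
    (hω : 1 + ω + ω ^ 2 = 0) {v : Fin m → ℝ} (hv : ∀ a, a ≠ i → a ≠ j → a ≠ k → v a = 0)
    (hsum : ∑ a, v a = 0) (hv0 : v ≠ 0) :
    ∃ z z' : ℂ, z * z' = 1 / 9 ∧ ∀ a b, ((householder v a b : ℝ) : ℂ) =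
      triangleMean i j k a b + z * (cubeVec ω i j k a * cubeVec ω i j k b) +
        z' * (cubeVec (ω ^ 2) i j k a * cubeVec (ω ^ 2) i j k b) := by
  have hsub : ∀ f : Fin m → ℝ, (∀ a, v a = 0 → f a = 0) → ∑ a, f a = f i + f j + f k := by
    intro f hf
    rw [← Finset.sum_subset (Finset.subset_univ {i, j, k})]
    · rw [Finset.sum_insert (by simp [hij, hik]), Finset.sum_insert (by simp [hjk]),
        Finset.sum_singleton, add_assoc]
    · intro a _ ha
      simp only [Finset.mem_insert, Finset.mem_singleton, not_or] at ha
      exact hf a (hv a ha.1 ha.2.1 ha.2.2)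
  have hs : v i + v j + v k = 0 := by rw [← hsub v fun _ h => h, hsum]
  have hdot : v ⬝ᵥ v = v i ^ 2 + v j ^ 2 + v k ^ 2 := by
    rw [dotProduct, hsub _ fun a h => by rw [h, zero_mul]]
    ring
  have hS : v i ^ 2 + v j ^ 2 + v k ^ 2 ≠ 0 := by
    rw [← hdot, Ne, dotProduct_self_eq_zero]
    exact hv0
  have hω3 : ω ^ 3 = 1 := by linear_combination (ω - 1) * hω
  have hω4 : ω ^ 4 = ω := by linear_combination ω * hω3
  have hω6 : ω ^ 6 = 1 := by linear_combination (ω ^ 3 + 1) * hω3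
  have hω8 : ω ^ 8 = ω ^ 2 := by linear_combination (ω ^ 5 + ω ^ 2) * hω3
  obtain ⟨z, z', hzz, h11, h22, h33, h12, h13, h23⟩ := exists_reflection_params hω hs hS
  refine ⟨z, z', hzz, fun a b => ?_⟩
  have hH : ((householder v a b : ℝ) : ℂ) = (if a = b then 1 else 0) -
      2 / ((v i : ℂ) ^ 2 + (v j : ℂ) ^ 2 + (v k : ℂ) ^ 2) * (v a * v b) := by
    rw [householder, hdot]
    simp only [Matrix.sub_apply, Matrix.smul_apply, vecMulVec_apply, Matrix.one_apply, smul_eq_mul]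
    split_ifs <;> push_cast <;> ring
  rw [hH]
  generalize 2 / ((v i : ℂ) ^ 2 + (v j : ℂ) ^ 2 + (v k : ℂ) ^ 2) = s at *
  have hji := hij.symm
  have hki := hik.symm
  have hkj := hjk.symm
  have hcases : ∀ a : Fin m, a = i ∨ a = j ∨ a = k ∨ (a ≠ i ∧ a ≠ j ∧ a ≠ k) := by
    intro a; tauto
  have hvz := fun a (h : a ≠ i ∧ a ≠ j ∧ a ≠ k) => hv a h.1 h.2.1 h.2.2
  have hne : ∀ a b : Fin m, (b ≠ i ∧ b ≠ j ∧ b ≠ k) → (a = i ∨ a = j ∨ a = k) → a ≠ b := by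
    rintro a b ⟨h1, h2, h3⟩ (rfl | rfl | rfl) <;> exact Ne.symm ‹_›
  clear hv hsum hsub hH
  have hci : ∀ ω : ℂ, cubeVec ω i j k i = 1 := fun _ => by simp [cubeVec]
  have hcj : ∀ ω : ℂ, cubeVec ω i j k j = ω := fun _ => by simp [cubeVec, hji]
  have hck : ∀ ω : ℂ, cubeVec ω i j k k = ω ^ 2 := fun _ => by simp [cubeVec, hki, hkj]
  have hcz : ∀ (ω : ℂ) a, (a ≠ i ∧ a ≠ j ∧ a ≠ k) → cubeVec ω i j k a = 0 := fun _ _ h => by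
    simp [cubeVec, h]
  have htin : ∀ a b, (a = i ∨ a = j ∨ a = k) → (b = i ∨ b = j ∨ b = k) →
      triangleMean i j k a b = 1 / 3 := fun a b h1 h2 => by simp [triangleMean, h1, h2]
  have htout : ∀ a b, (a ≠ i ∧ a ≠ j ∧ a ≠ k) →
      triangleMean i j k a b = if a = b then 1 else 0 := fun a b h => by
    simp [triangleMean, h]
  have htout' : ∀ a b, (b ≠ i ∧ b ≠ j ∧ b ≠ k) →
      triangleMean i j k a b = if a = b then 1 else 0 := fun a b h => by
    by_cases ha : a = i ∨ a = j ∨ a = k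
    · simp [triangleMean, h, ha, hne a b h ha]
    · simp [triangleMean, ha]
  rcases hcases a with ha | ha | ha | ha
  case inr.inr.inr => simp [hcz _ a ha, htout a b ha, hvz a ha]
  all_goals
    rcases hcases b with hb | hb | hb | hb
    case inr.inr.inr => simp [hcz _ b hb, htout' a b hb, hvz b hb]
    all_goals
      rw [htin a b (by tauto) (by tauto), ha, hb]
      simp only [hci, hcj, hck, if_true, hij, hik, hjk, hji, hki, hkj, if_false]
      grind

end TriangleQuadrature

/-! ### Row invariance under reflections along sum-zero vectors -/

section RowInvariance

open Matrix

variable {m n : ℕ}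

theorem eval_charpoly_bipartite_pencil (A : Matrix (Fin m) (Fin n) ℝ)
    (A₀ : Matrix (Fin m) (Fin n) ℂ) (w w' : Fin m → ℂ) (b b' : Fin n → ℂ) (z z' : ℂ)
    (h : ∀ s t, (A s t : ℂ) = A₀ s t + z * (w s * b t) + z' * (w' s * b' t)) (x : ℝ) :
    (((bipartiteMatrix A).charpoly.eval x : ℝ) : ℂ) =
      (Matrix.fromBlocks ((x : ℂ) • 1) (-A₀) (-A₀ᵀ) ((x : ℂ) • 1) +
        z • (vecMulVec (Sum.elim (-w) 0) (Sum.elim 0 b) +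
          vecMulVec (Sum.elim 0 b) (Sum.elim (-w) 0)) +
        z' • (vecMulVec (Sum.elim (-w') 0) (Sum.elim 0 b') +
          vecMulVec (Sum.elim 0 b') (Sum.elim (-w') 0))).det := by
  rw [Matrix.eval_charpoly]
  refine (RingHom.map_det Complex.ofRealHom _).trans ?_
  congr 1
  ext (s | s) (t | t)
  · by_cases hst : s = t <;> simp [bipartiteMatrix, vecMulVec_apply, hst]
  · simp [bipartiteMatrix, vecMulVec_apply, h]; ring
  · simp [bipartiteMatrix, vecMulVec_apply, h]; ring
  · by_cases hst : s = t <;> simp [bipartiteMatrix, vecMulVec_apply, hst]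

/-- The cycle fixes the mean part and acts on the cube vectors by `ω` and `ω ^ 2`. Both sides are
thus cube-root averages of one pencil, with the same parameter product `1 / 9`. -/
theorem sum_threeCycle_charpoly {i j k : Fin m} (hij : i ≠ j) (hik : i ≠ k) (hjk : j ≠ k)
    {v w : Fin m → ℝ} (hv : ∀ a, a ≠ i → a ≠ j → a ≠ k → v a = 0) (hvsum : ∑ a, v a = 0)
    (hv0 : v ≠ 0) (hw : ∀ a, a ≠ i → a ≠ j → a ≠ k → w a = 0) (hwsum : ∑ a, w a = 0)
    (hw0 : w ≠ 0) (A B : Matrix (Fin m) (Fin n) ℝ) :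
    (∑ l : Fin 3, (bipartiteMatrix
      (A + (householder v * B).submatrix (threeCycle i j k ^ (l : ℕ)) id)).charpoly) =
    ∑ l : Fin 3, (bipartiteMatrix
      (A + (householder w * B).submatrix (threeCycle i j k ^ (l : ℕ)) id)).charpoly := by
  obtain ⟨ω, hω⟩ : ∃ ω : ℂ, 1 + ω + ω ^ 2 = 0 := by
    have h := (Complex.isPrimitiveRoot_exp 3 (by norm_num)).geom_sum_eq_zero (by norm_num)
    exact ⟨_, by simpa [Finset.sum_range_succ] using h⟩
  have hω3 : ω ^ 3 = 1 := by linear_combination (ω - 1) * hω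
  have hω23 : (ω ^ 2) ^ 3 = 1 := by rw [← pow_mul, mul_comm, pow_mul, hω3, one_pow]
  have hpow : ∀ {η : ℂ}, η ^ 3 = 1 → ∀ (l : ℕ) a,
      cubeVec η i j k ((threeCycle i j k ^ l) a) = η ^ l * cubeVec η i j k a := by
    intro η hη l
    induction l with
    | zero => intro a; simp
    | succ l ih =>
      intro a
      rw [pow_succ, Equiv.Perm.mul_apply, ih, cubeVec_threeCycle hij hik hjk hη]
      ring
  have hmean : ∀ (l : ℕ) a b, triangleMean i j k ((threeCycle i j k ^ l) a) b =
      triangleMean i j k a b := by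
    intro l
    induction l with
    | zero => intro a b; simp
    | succ l ih =>
      intro a b
      rw [pow_succ, Equiv.Perm.mul_apply, ih, triangleMean_threeCycle hij hik hjk]
  have hdec : ∀ u : Fin m → ℝ, (∀ a, a ≠ i → a ≠ j → a ≠ k → u a = 0) → ∑ a, u a = 0 → u ≠ 0 →
      ∃ z z' : ℂ, z * z' = 1 / 9 ∧ ∀ (l : ℕ) s t,
        ((A + (householder u * B).submatrix (threeCycle i j k ^ l) id : Matrix _ _ ℝ) s t : ℂ) =
          (A.map Complex.ofReal + triangleMean i j k * B.map Complex.ofReal) s t +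
          (ω ^ l * z) * (cubeVec ω i j k s * (∑ r, cubeVec ω i j k r * B r t)) +
          ((ω ^ 2) ^ l * z') *
            (cubeVec (ω ^ 2) i j k s * (∑ r, cubeVec (ω ^ 2) i j k r * B r t)) := by
    intro u hu husum hu0
    obtain ⟨z, z', hzz, hH⟩ := householder_eq_triangle hij hik hjk hω hu husum hu0
    refine ⟨z, z', hzz, fun l s t => ?_⟩
    simp only [Matrix.add_apply, Matrix.submatrix_apply, Matrix.mul_apply, Complex.ofReal_add,
      Complex.ofReal_sum, Complex.ofReal_mul, hH, hmean, hpow hω3, hpow hω23, Matrix.map_apply, id,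
      Finset.mul_sum, add_assoc, ← Finset.sum_add_distrib]
    congr 1
    refine Finset.sum_congr rfl fun r _ => ?_
    ring
  obtain ⟨z, z', hz, hz'⟩ := hdec v hv hvsum hv0
  obtain ⟨y, y', hy, hy'⟩ := hdec w hw hwsum hw0
  apply Polynomial.funext
  intro x
  have h1 := fun l : Fin 3 => eval_charpoly_bipartite_pencil _ _ _ _ _ _ _ _ (hz' l) x
  have h2 := fun l : Fin 3 => eval_charpoly_bipartite_pencil _ _ _ _ _ _ _ _ (hy' l) x
  apply Complex.ofReal_injective
  simp only [Polynomial.eval_finsetSum, Complex.ofReal_sum, h1, h2]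
  exact sum_cubeRoots_det_pencil _ _ _ _ _ hω (hz.trans hy.symm)

theorem three_mul_sum_perm (ρ : Equiv.Perm (Fin m)) (A B : Matrix (Fin m) (Fin n) ℝ) :
    (3 : ℝ[X]) * ∑ σ : Equiv.Perm (Fin m), (bipartiteMatrix (A + B.submatrix σ id)).charpoly =
      ∑ σ : Equiv.Perm (Fin m), ∑ l : Fin 3,
        (bipartiteMatrix (A.submatrix σ.symm id + B.submatrix (ρ ^ (l : ℕ)) id)).charpoly := by
  rw [Finset.sum_comm]
  have h : ∀ l : Fin 3, (∑ σ : Equiv.Perm (Fin m),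
      (bipartiteMatrix (A.submatrix σ.symm id + B.submatrix (ρ ^ (l : ℕ)) id)).charpoly) =
      ∑ σ : Equiv.Perm (Fin m), (bipartiteMatrix (A + B.submatrix σ id)).charpoly := by
    intro l
    rw [← Equiv.sum_comp (Equiv.mulLeft (ρ ^ (l : ℕ))) fun σ : Equiv.Perm (Fin m) =>
      (bipartiteMatrix (A + B.submatrix σ id)).charpoly]
    refine Finset.sum_congr rfl fun σ _ => ?_
    rw [← charpoly_bipartite_submatrix _ σ 1]
    congr 2
    ext a b
    simp
  rw [Finset.sum_congr rfl fun l _ => h l]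
  simp

/-- The reflection is compared with the one along `e_i - e_j`, a transposition matrix, by splitting
the permutation sum along powers of the three-cycle. -/
theorem rowInvariant_householder_triangle {i j k : Fin m} (hij : i ≠ j) (hik : i ≠ k)
    (hjk : j ≠ k) {v : Fin m → ℝ} (hv : ∀ a, a ≠ i → a ≠ j → a ≠ k → v a = 0)
    (hvsum : ∑ a, v a = 0) (hv0 : v ≠ 0) : RowInvariant (householder v) := by
  intro n A B
  have hswap := rowInvariant_perm (Equiv.swap i j) (householder_single_sub hij one_ne_zero) n A B
  rw [← hswap]
  have h3 : (3 : ℝ[X]) ≠ 0 := by exact_mod_cast (by norm_num : (3 : ℕ) ≠ 0)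
  apply mul_left_cancel₀ h3
  rw [three_mul_sum_perm (threeCycle i j k), three_mul_sum_perm (threeCycle i j k)]
  refine Finset.sum_congr rfl fun σ _ => ?_
  refine sum_threeCycle_charpoly hij hik hjk hv hvsum hv0 ?_ ?_ ?_ _ _
  · intro a h1 h2 _
    simp [h1, h2]
  · simp
  · intro h
    have := congrFun h i
    simp [hij] at this

theorem exists_pair_sum_sq {a b c : ℝ} (hab : a * b ≤ 0) :
    ∃ y z : ℝ, y + z = a + b + c ∧ y ^ 2 + z ^ 2 = a ^ 2 + b ^ 2 + c ^ 2 := by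
  set s := a + b + c
  set q := a ^ 2 + b ^ 2 + c ^ 2
  -- The discriminant equals `(a + b - c) ^ 2 - 4 * a * b`.
  have hq : 0 ≤ 2 * q - s ^ 2 := by
    simp only [q, s]
    nlinarith [sq_nonneg (a + b - c)]
  refine ⟨(s + √(2 * q - s ^ 2)) / 2, (s - √(2 * q - s ^ 2)) / 2, by ring, ?_⟩
  have := Real.sq_sqrt hq
  linear_combination this / 2

/-- Induction on the support. A positive and a negative entry allow three entries to be replaced by
`0, y, z` with the same sum and norm, giving `w` of smaller support. The reflection along `v - w`,
supported on three coordinates, conjugates one reflection into the other. A support of two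
coordinates gives a transposition. -/
theorem rowInvariant_householder (v : Fin m → ℝ) (hsum : ∑ a, v a = 0) :
    RowInvariant (householder v) := by
  induction hN : (Finset.univ.filter fun a => v a ≠ 0).card using Nat.strong_induction_on
    generalizing v with
  | _ N ih =>
    by_cases hv0 : v = 0
    · subst hv0
      have : householder (0 : Fin m → ℝ) = 1 := by simp [householder]
      rw [this]
      exact RowInvariant.one
    obtain ⟨i, hi⟩ : ∃ i, 0 < v i := by
      by_contra! h
      exact hv0 (funext fun a =>
        (Finset.sum_eq_zero_iff_of_nonpos fun a _ => h a).1 hsum a (Finset.mem_univ a))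
    obtain ⟨j, hj⟩ : ∃ j, v j < 0 := by
      by_contra! h
      exact hv0 (funext fun a =>
        (Finset.sum_eq_zero_iff_of_nonneg fun a _ => h a).1 hsum a (Finset.mem_univ a))
    have hij : i ≠ j := by
      rintro rfl
      linarith
    by_cases hk : ∃ k, k ≠ i ∧ k ≠ j ∧ v k ≠ 0
    · obtain ⟨k, hki, hkj, hk0⟩ := hk
      obtain ⟨y, z, hyz, hyz2⟩ := exists_pair_sum_sq (a := v i) (b := v j) (c := v k)
        (mul_nonpos_of_nonneg_of_nonpos hi.le hj.le)
      set w : Fin m → ℝ := fun a => if a = i then 0 else if a = j then y else if a = k then z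
        else v a with hw
      have hwi : w i = 0 := by simp [hw]
      have hwj : w j = y := by simp [hw, hij.symm]
      have hwk : w k = z := by simp [hw, hki, hkj]
      have hwv : ∀ a, a ≠ i → a ≠ j → a ≠ k → w a = v a := by
        intro a h1 h2 h3
        simp [hw, h1, h2, h3]
      have hsplit : ∀ f g : Fin m → ℝ, (∀ a, a ≠ i → a ≠ j → a ≠ k → f a = g a) →
          f i + f j + f k = g i + g j + g k → ∑ a, f a = ∑ a, g a := by
        intro f g h1 h2
        have h3 : ∀ f : Fin m → ℝ, ∑ a, f a = (f i + f j + f k) + ∑ a ∈ {i, j, k}ᶜ, f a := by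
          intro f
          rw [← Finset.sum_add_sum_compl {i, j, k} f,
            Finset.sum_insert (by simp [hij, hki.symm]), Finset.sum_insert (by simp [hkj.symm]),
            Finset.sum_singleton]
          ring
        rw [h3 f, h3 g, h2]
        congr 1
        refine Finset.sum_congr rfl fun a ha => ?_
        simp only [Finset.mem_compl, Finset.mem_insert, Finset.mem_singleton, not_or] at ha
        exact h1 a ha.1 ha.2.1 ha.2.2
      have hwsum : ∑ a, w a = 0 := by
        rw [← hsum]
        exact hsplit w v hwv (by rw [hwi, hwj, hwk]; linarith)
      have hnorm : v ⬝ᵥ v = w ⬝ᵥ w := by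
        refine (hsplit (fun a => w a * w a) (fun a => v a * v a) ?_ ?_).symm
        · intro a h1 h2 h3
          simp only [hwv a h1 h2 h3]
        · simp only [hwi, hwj, hwk]
          linarith
      have hlt : (Finset.univ.filter fun a => w a ≠ 0).card < N := by
        rw [← hN]
        apply Finset.card_lt_card
        rw [Finset.ssubset_iff_of_subset]
        · exact ⟨i, by simp [hi.ne'], by simp [hwi]⟩
        · intro a ha
          simp only [Finset.mem_filter, Finset.mem_univ, true_and] at ha ⊢
          by_cases h1 : a = i
          · exact absurd (h1 ▸ hwi) ha
          by_cases h2 : a = j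
          · rw [h2]; exact hj.ne
          by_cases h3 : a = k
          · rw [h3]; exact hk0
          · rwa [hwv a h1 h2 h3] at ha
      have hd : RowInvariant (householder (v - w)) := by
        refine rowInvariant_householder_triangle hij hki.symm hkj.symm ?_ ?_ ?_
        · intro a h1 h2 h3
          simp [hwv a h1 h2 h3]
        · simp [hsum, hwsum]
        · intro h
          have := congrFun h i
          simp [hwi, hi.ne'] at this
      rw [← householder_conj v w hnorm]
      exact (hd.mul (ih _ hlt w hwsum rfl)).mul hd
    · push Not at hk
      have hvj : v j = -v i := by
        have h : ∑ a, v a = v i + v j := by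
          rw [← Finset.sum_subset (Finset.subset_univ {i, j}), Finset.sum_pair hij]
          intro a _ ha
          simp only [Finset.mem_insert, Finset.mem_singleton, not_or] at ha
          exact hk a ha.1 ha.2
        linarith
      have hv : v = Pi.single i (v i) - Pi.single j (v i) := by
        funext a
        by_cases h1 : a = i
        · subst h1; simp [hij]
        by_cases h2 : a = j
        · subst h2; simp [h1, hvj]
        · simp [h1, h2, hk a h1 h2]
      rw [hv]
      exact rowInvariant_perm (Equiv.swap i j) (householder_single_sub hij hi.ne')

end RowInvariance

/-! ### Transfer to the complement of the all-ones vector -/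

section OrthogonalComplement

open Matrix

theorem unitOnes_dotProduct_self (r : ℕ) : unitOnes (r + 1) ⬝ᵥ unitOnes (r + 1) = 1 := by
  have h : (0 : ℝ) ≤ ((r + 1 : ℕ) : ℝ) := by positivity
  have h' : ((r + 1 : ℕ) : ℝ) ≠ 0 := by positivity
  simp only [dotProduct, unitOnes, Finset.sum_const, Finset.card_univ, Fintype.card_fin,
    nsmul_eq_mul]
  rw [div_mul_div_comm, one_mul, Real.mul_self_sqrt h, mul_one_div_cancel h']

/-- A matrix whose columns form an orthonormal basis of the orthogonal complement of the all-ones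
vector. -/
def onesCompl (r : ℕ) : Matrix (Fin (r + 1)) (Fin r) ℝ :=
  (householder (unitOnes (r + 1) - Pi.single 0 1)).submatrix id Fin.succ

/-- The reflection carries the first basis vector to the unit all-ones vector, so its other columns
form an orthonormal basis of the complement. -/
theorem householder_col_zero (r : ℕ) (a : Fin (r + 1)) :
    householder (unitOnes (r + 1) - Pi.single 0 1) a 0 = unitOnes (r + 1) a := by
  have h := householder_sub_mulVec (unitOnes (r + 1)) (Pi.single 0 1)
    (by rw [unitOnes_dotProduct_self]; simp)
  simpa using congrFun h a

theorem householder_row_zero (r : ℕ) (a : Fin (r + 1)) :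
    householder (unitOnes (r + 1) - Pi.single 0 1) 0 a = unitOnes (r + 1) a := by
  rw [← householder_col_zero, ← transpose_apply (householder _), householder_transpose]

theorem onesCompl_transpose_mul (r : ℕ) : (onesCompl r)ᵀ * onesCompl r = 1 := by
  have h := householder_mul_self (unitOnes (r + 1) - Pi.single 0 1)
  ext a b
  have := congrFun (congrFun h a.succ) b.succ
  rw [Matrix.one_apply, Matrix.mul_apply] at this
  rw [Matrix.mul_apply, Matrix.one_apply]
  simp only [Fin.succ_inj] at this
  rw [← this]
  refine Finset.sum_congr rfl fun c _ => ?_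
  rw [transpose_apply, onesCompl, submatrix_apply, submatrix_apply, id,
    ← transpose_apply (householder _), householder_transpose]

theorem onesCompl_mul_transpose (r : ℕ) :
    onesCompl r * (onesCompl r)ᵀ + vecMulVec (unitOnes (r + 1)) (unitOnes (r + 1)) = 1 := by
  have h := householder_mul_self (unitOnes (r + 1) - Pi.single 0 1)
  ext a b
  have := congrFun (congrFun h a) b
  rw [Matrix.mul_apply, Fin.sum_univ_succ, householder_col_zero, householder_row_zero] at this
  rw [← this, Matrix.add_apply, Matrix.mul_apply, vecMulVec_apply, add_comm]
  congr 1
  refine Finset.sum_congr rfl fun c _ => ?_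
  rw [transpose_apply, onesCompl, submatrix_apply, submatrix_apply, id, id,
    ← transpose_apply (householder _) _ b, householder_transpose]

theorem onesCompl_transpose_mulVec (r : ℕ) : (onesCompl r)ᵀ *ᵥ unitOnes (r + 1) = 0 := by
  have h := householder_mul_self (unitOnes (r + 1) - Pi.single 0 1)
  ext a
  have := congrFun (congrFun h 0) a.succ
  rw [Matrix.one_apply, Matrix.mul_apply, if_neg (Fin.succ_ne_zero a).symm] at this
  simp_rw [householder_row_zero] at this
  rw [mulVec, dotProduct]
  refine Eq.trans (Finset.sum_congr rfl fun c _ => by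
    rw [transpose_apply, onesCompl, submatrix_apply, id, mul_comm]) this

theorem unitOnes_vecMul_onesCompl (r : ℕ) : unitOnes (r + 1) ᵥ* onesCompl r = 0 := by
  rw [← mulVec_transpose, onesCompl_transpose_mulVec]

theorem sum_onesCompl_mulVec (r : ℕ) (x : Fin r → ℝ) : ∑ a, (onesCompl r *ᵥ x) a = 0 := by
  have h : unitOnes (r + 1) ⬝ᵥ (onesCompl r *ᵥ x) = 0 := by
    rw [dotProduct_mulVec, unitOnes_vecMul_onesCompl, zero_dotProduct]
  simp only [dotProduct, unitOnes, ← Finset.mul_sum] at h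
  refine (mul_eq_zero.1 h).resolve_left ?_
  have : (0 : ℝ) < ((r + 1 : ℕ) : ℝ) := by positivity
  exact one_div_ne_zero (Real.sqrt_ne_zero'.2 this)

/-- The extension of a linear map on the orthogonal complement of the all-ones vector by the
identity on the all-ones vector. -/
def onesExtend {r : ℕ} (Q : Matrix (Fin r) (Fin r) ℝ) : Matrix (Fin (r + 1)) (Fin (r + 1)) ℝ :=
  onesCompl r * Q * (onesCompl r)ᵀ + vecMulVec (unitOnes (r + 1)) (unitOnes (r + 1))

variable {r : ℕ}

theorem onesCompl_transpose_mul_onesExtend (Q : Matrix (Fin r) (Fin r) ℝ) :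
    (onesCompl r)ᵀ * onesExtend Q = Q * (onesCompl r)ᵀ := by
  rw [onesExtend, Matrix.mul_add, mul_vecMulVec, onesCompl_transpose_mulVec, zero_vecMulVec,
    add_zero, ← Matrix.mul_assoc, ← Matrix.mul_assoc, onesCompl_transpose_mul, Matrix.one_mul]

theorem vecMul_onesExtend (Q : Matrix (Fin r) (Fin r) ℝ) :
    unitOnes (r + 1) ᵥ* onesExtend Q = unitOnes (r + 1) := by
  rw [onesExtend, vecMul_add, ← vecMul_vecMul, ← vecMul_vecMul, unitOnes_vecMul_onesCompl,
    zero_vecMul, zero_vecMul, zero_add, vecMul_vecMulVec, unitOnes_dotProduct_self, one_smul]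

theorem onesExtend_transpose (Q : Matrix (Fin r) (Fin r) ℝ) :
    (onesExtend Q)ᵀ = onesExtend Qᵀ := by
  simp [onesExtend, transpose_vecMulVec, Matrix.mul_assoc]

theorem onesExtend_mulVec (Q : Matrix (Fin r) (Fin r) ℝ) :
    onesExtend Q *ᵥ unitOnes (r + 1) = unitOnes (r + 1) := by
  rw [← vecMul_transpose, onesExtend_transpose, vecMul_onesExtend]

theorem onesExtend_mul (P Q : Matrix (Fin r) (Fin r) ℝ) :
    onesExtend (P * Q) = onesExtend P * onesExtend Q := by
  conv_rhs => rw [onesExtend.eq_1 P]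
  rw [Matrix.add_mul, vecMulVec_mul, vecMul_onesExtend, Matrix.mul_assoc _ _ (onesExtend Q),
    onesCompl_transpose_mul_onesExtend, onesExtend]
  simp only [Matrix.mul_assoc]

/-- `onesCompl` is an isometry onto the sum-zero hyperplane, so reflections of the complement extend
to reflections covered by `rowInvariant_householder`. -/
theorem onesExtend_householder (x : Fin r → ℝ) :
    onesExtend (householder x) = householder (onesCompl r *ᵥ x) := by
  have hd : (onesCompl r *ᵥ x) ⬝ᵥ (onesCompl r *ᵥ x) = x ⬝ᵥ x := by
    rw [dotProduct_mulVec, ← mulVec_transpose, mulVec_mulVec, onesCompl_transpose_mul, one_mulVec]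
  rw [onesExtend, householder, householder, hd, Matrix.mul_sub, Matrix.sub_mul, Matrix.mul_one,
    Matrix.mul_smul, Matrix.smul_mul, mul_vecMulVec, vecMulVec_mul, vecMul_transpose,
    ← onesCompl_mul_transpose]
  abel

theorem rowInvariant_onesExtend_householder (x : Fin r → ℝ) :
    RowInvariant (onesExtend (householder x)) := by
  rw [onesExtend_householder]
  exact rowInvariant_householder _ (sum_onesCompl_mulVec r x)

theorem rowInvariant_onesExtend_one : RowInvariant (onesExtend (1 : Matrix (Fin r) (Fin r) ℝ)) := by
  rw [onesExtend, Matrix.mul_one, onesCompl_mul_transpose]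
  exact RowInvariant.one

/-- The signed permutation matrix with signs `ε` and permutation `σ`. -/
def signedPerm (ε : Fin r → ℤˣ) (σ : Equiv.Perm (Fin r)) : Matrix (Fin r) (Fin r) ℝ :=
  Matrix.diagonal (fun a => ((ε a : ℤ) : ℝ)) * (1 : Matrix (Fin r) (Fin r) ℝ).submatrix σ id

theorem rowInvariant_onesExtend_perm (σ : Equiv.Perm (Fin r)) :
    RowInvariant (onesExtend ((1 : Matrix (Fin r) (Fin r) ℝ).submatrix σ id)) := by
  induction σ using Equiv.Perm.swap_induction_on with
  | one =>
    rw [Equiv.Perm.coe_one, submatrix_id_id]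
    exact rowInvariant_onesExtend_one
  | swap_mul f x y hxy ih =>
    have : (1 : Matrix (Fin r) (Fin r) ℝ).submatrix (Equiv.swap x y * f) id =
        (1 : Matrix (Fin r) (Fin r) ℝ).submatrix f id *
          (1 : Matrix (Fin r) (Fin r) ℝ).submatrix (Equiv.swap x y) id := by
      ext a b
      rw [Matrix.mul_apply, Finset.sum_eq_single (f a)]
      · simp [Matrix.one_apply]
      · intro c _ hc
        simp [Matrix.one_apply, hc.symm]
      · simp
    rw [this, onesExtend_mul]
    refine ih.mul ?_
    rw [← householder_single_sub hxy one_ne_zero]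
    exact rowInvariant_onesExtend_householder _

/-- Each sign change is the reflection along a coordinate vector. -/
theorem rowInvariant_onesExtend_diagonal (S : Finset (Fin r)) :
    RowInvariant (onesExtend (Matrix.diagonal fun a => if a ∈ S then (-1 : ℝ) else 1)) := by
  induction S using Finset.induction_on with
  | empty => simpa using rowInvariant_onesExtend_one
  | insert a S ha ih =>
    have : (Matrix.diagonal fun b => if b ∈ insert a S then (-1 : ℝ) else 1) =
        householder (Pi.single a 1) * Matrix.diagonal fun b => if b ∈ S then (-1 : ℝ) else 1 := by
      ext b c
      rw [Matrix.mul_diagonal, householder]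
      by_cases hbc : b = c
      · subst hbc
        by_cases hb : b = a
        · subst hb; simp [vecMulVec_apply, ha]; norm_num
        · simp [vecMulVec_apply, hb]
      · by_cases hb : b = a
        · subst hb; simp [vecMulVec_apply, hbc, Ne.symm hbc]
        · simp [vecMulVec_apply, hbc, hb]
    rw [this, onesExtend_mul]
    exact (rowInvariant_onesExtend_householder _).mul ih

theorem rowInvariant_onesExtend_signedPerm (ε : Fin r → ℤˣ) (σ : Equiv.Perm (Fin r)) :
    RowInvariant (onesExtend (signedPerm ε σ)) := by
  rw [signedPerm, onesExtend_mul]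
  refine RowInvariant.mul ?_ (rowInvariant_onesExtend_perm σ)
  have : (fun a => ((ε a : ℤ) : ℝ)) =
      fun a => if a ∈ Finset.univ.filter (fun a => ε a = -1) then (-1 : ℝ) else 1 := by
    funext a
    rcases Int.units_eq_one_or (ε a) with h | h <;> simp [h]
  rw [this]
  exact rowInvariant_onesExtend_diagonal _

/-- Transposition exchanges rows and columns without changing the bipartite characteristic
polynomial. -/
theorem RowInvariant.sum_col {n : ℕ} {Q : Matrix (Fin n) (Fin n) ℝ} (hQ : RowInvariant Q) {m : ℕ}
    (A B : Matrix (Fin m) (Fin n) ℝ) :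
    (∑ τ : Equiv.Perm (Fin n), (bipartiteMatrix (A + (B * Qᵀ).submatrix id τ)).charpoly) =
      ∑ τ : Equiv.Perm (Fin n), (bipartiteMatrix (A + B.submatrix id τ)).charpoly := by
  have h := hQ m Aᵀ Bᵀ
  have h1 : ∀ τ : Equiv.Perm (Fin n), (bipartiteMatrix (Aᵀ + (Q * Bᵀ).submatrix τ id)).charpoly =
      (bipartiteMatrix (A + (B * Qᵀ).submatrix id τ)).charpoly := by
    intro τ
    rw [← charpoly_bipartite_transpose]
    congr 2
    ext a b
    simp [Matrix.mul_apply, mul_comm]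
  have h2 : ∀ τ : Equiv.Perm (Fin n), (bipartiteMatrix (Aᵀ + Bᵀ.submatrix τ id)).charpoly =
      (bipartiteMatrix (A + B.submatrix id τ)).charpoly := by
    intro τ
    rw [← charpoly_bipartite_transpose]
    congr 2
  rw [← Finset.sum_congr rfl fun τ _ => h1 τ, h, Finset.sum_congr rfl fun τ _ => h2 τ]

theorem sum_perm_perm_invariant {m n : ℕ} {P : Matrix (Fin m) (Fin m) ℝ}
    {Q : Matrix (Fin n) (Fin n) ℝ} (hP : RowInvariant P) (hQ : RowInvariant Q)
    (A B : Matrix (Fin m) (Fin n) ℝ) :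
    (∑ σ : Equiv.Perm (Fin m), ∑ τ : Equiv.Perm (Fin n),
      (bipartiteMatrix (A + (P * B * Qᵀ).submatrix σ τ)).charpoly) =
    ∑ σ : Equiv.Perm (Fin m), ∑ τ : Equiv.Perm (Fin n),
      (bipartiteMatrix (A + B.submatrix σ τ)).charpoly := by
  have h1 : ∀ (σ : Equiv.Perm (Fin m)) (τ : Equiv.Perm (Fin n)),
      (P * B * Qᵀ).submatrix σ τ = ((P * B).submatrix σ id * Qᵀ).submatrix id τ := by
    intro σ τ
    ext a b
    simp [Matrix.mul_apply]
  simp_rw [h1, hQ.sum_col, submatrix_submatrix]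
  rw [Finset.sum_comm, Finset.sum_comm (s := Finset.univ (α := Equiv.Perm (Fin m)))]
  refine Finset.sum_congr rfl fun τ _ => ?_
  have h2 : ∀ σ : Equiv.Perm (Fin m), (P * B).submatrix (σ ∘ id) (id ∘ τ) =
      (P * B.submatrix id τ).submatrix σ id := by
    intro σ
    ext a b
    simp [Matrix.mul_apply]
  simp_rw [h2]
  rw [hP]
  simp only [submatrix_submatrix]
  rfl

end OrthogonalComplement

/-! ### The formula for two summands -/

section TwoSummands

open Matrix

variable {M N : ℕ}

/-- The compression of `A` to the orthogonal complements of the all-ones vectors. -/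
def onesReduce (A : Matrix (Fin (M + 1)) (Fin (N + 1)) ℝ) : Matrix (Fin M) (Fin N) ℝ :=
  (onesCompl M)ᵀ * A * onesCompl N

/-- The all-ones vectors are a pair of singular vectors of `A` with singular value `a`. -/
def OnesSingular (A : Matrix (Fin (M + 1)) (Fin (N + 1)) ℝ) (a : ℝ) : Prop :=
  A *ᵥ unitOnes (N + 1) = a • unitOnes (M + 1) ∧ Aᵀ *ᵥ unitOnes (M + 1) = a • unitOnes (N + 1)

theorem OnesSingular.add {A B : Matrix (Fin (M + 1)) (Fin (N + 1)) ℝ} {a b : ℝ}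
    (hA : OnesSingular A a) (hB : OnesSingular B b) : OnesSingular (A + B) (a + b) :=
  ⟨by rw [add_mulVec, hA.1, hB.1, add_smul],
    by rw [transpose_add, add_mulVec, hA.2, hB.2, add_smul]⟩

theorem OnesSingular.submatrix {A : Matrix (Fin (M + 1)) (Fin (N + 1)) ℝ} {a : ℝ}
    (hA : OnesSingular A a) (σ : Equiv.Perm (Fin (M + 1))) (τ : Equiv.Perm (Fin (N + 1))) :
    OnesSingular (A.submatrix σ τ) a := by
  constructor
  · rw [submatrix_mulVec_equiv]
    have : unitOnes (N + 1) ∘ τ.symm = unitOnes (N + 1) := rfl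
    rw [this, hA.1]
    rfl
  · rw [transpose_submatrix, submatrix_mulVec_equiv]
    have : unitOnes (M + 1) ∘ σ.symm = unitOnes (M + 1) := rfl
    rw [this, hA.2]
    rfl

theorem OnesSingular.conj {A : Matrix (Fin (M + 1)) (Fin (N + 1)) ℝ} {a : ℝ}
    (hA : OnesSingular A a) (P : Matrix (Fin M) (Fin M) ℝ) (Q : Matrix (Fin N) (Fin N) ℝ) :
    OnesSingular (onesExtend P * A * (onesExtend Q)ᵀ) a := by
  constructor
  · rw [← mulVec_mulVec, ← mulVec_mulVec, onesExtend_transpose, onesExtend_mulVec, hA.1,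
      mulVec_smul, onesExtend_mulVec]
  · rw [transpose_mul, transpose_mul, transpose_transpose, ← mulVec_mulVec, ← mulVec_mulVec,
      onesExtend_transpose, onesExtend_mulVec, hA.2, mulVec_smul, onesExtend_mulVec]

theorem onesReduce_conj (A : Matrix (Fin (M + 1)) (Fin (N + 1)) ℝ) (P : Matrix (Fin M) (Fin M) ℝ)
    (Q : Matrix (Fin N) (Fin N) ℝ) :
    onesReduce (onesExtend P * A * (onesExtend Q)ᵀ) = P * onesReduce A * Qᵀ := by
  have h : (onesExtend Q)ᵀ * onesCompl N = onesCompl N * Qᵀ := by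
    have := congrArg transpose (onesCompl_transpose_mul_onesExtend Q)
    simpa [transpose_mul] using this
  rw [onesReduce, onesReduce, ← Matrix.mul_assoc, ← Matrix.mul_assoc,
    onesCompl_transpose_mul_onesExtend, Matrix.mul_assoc _ _ (onesCompl N), h]
  simp only [Matrix.mul_assoc]

/-- The identity is split on both sides into the projections onto the all-ones line and its
complement; the singular pair kills the mixed terms. -/
theorem OnesSingular.eq_reduce {A : Matrix (Fin (M + 1)) (Fin (N + 1)) ℝ} {a : ℝ}
    (hA : OnesSingular A a) :
    A = onesCompl M * onesReduce A * (onesCompl N)ᵀ +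
      a • vecMulVec (unitOnes (M + 1)) (unitOnes (N + 1)) := by
  have hv : unitOnes (M + 1) ᵥ* A = a • unitOnes (N + 1) := by rw [← mulVec_transpose, hA.2]
  have h1 : onesCompl M * onesReduce A * (onesCompl N)ᵀ =
      (onesCompl M * (onesCompl M)ᵀ) * A * (onesCompl N * (onesCompl N)ᵀ) := by
    simp only [onesReduce, Matrix.mul_assoc]
  rw [h1, eq_sub_of_add_eq (onesCompl_mul_transpose M), eq_sub_of_add_eq (onesCompl_mul_transpose N),
    Matrix.sub_mul, Matrix.one_mul, vecMulVec_mul, hv, Matrix.mul_sub, Matrix.mul_one,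
    Matrix.sub_mul, mul_vecMulVec, hA.1, vecMulVec_mul_vecMulVec, smul_dotProduct,
    unitOnes_dotProduct_self]
  simp [vecMulVec_smul, smul_vecMulVec]

theorem OnesSingular.charpoly_gram {A : Matrix (Fin (M + 1)) (Fin (N + 1)) ℝ} {a : ℝ}
    (hA : OnesSingular A a) :
    (Aᵀ * A).charpoly = (X - C (a ^ 2)) * ((onesReduce A)ᵀ * onesReduce A).charpoly := by
  set F : Matrix (Fin (N + 1)) (Fin N ⊕ Unit) ℝ :=
    Matrix.fromCols (onesCompl N) (Matrix.of fun i _ => unitOnes (N + 1) i) with hF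
  have hFF : Fᵀ * F = 1 := by
    ext (i | i) (j | j)
    · have := congrFun (congrFun (onesCompl_transpose_mul N) i) j
      simpa [hF, Matrix.mul_apply, Matrix.one_apply] using this
    · have := congrFun (onesCompl_transpose_mulVec N) i
      simpa [hF, Matrix.mul_apply, mulVec, dotProduct] using this
    · have := congrFun (unitOnes_vecMul_onesCompl N) j
      simpa [hF, Matrix.mul_apply, vecMul, dotProduct] using this
    · have := unitOnes_dotProduct_self N
      simpa [hF, Matrix.mul_apply, dotProduct] using this
  set G : Matrix (Fin N ⊕ Unit) (Fin N ⊕ Unit) ℝ :=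
    Matrix.fromBlocks ((onesReduce A)ᵀ * onesReduce A) 0 0 (Matrix.of fun _ _ => a ^ 2) with hG
  have hAA : Aᵀ * A = F * (G * Fᵀ) := by
    have h1 : F * (G * Fᵀ) = onesCompl N * ((onesReduce A)ᵀ * onesReduce A) * (onesCompl N)ᵀ +
        (a ^ 2) • vecMulVec (unitOnes (N + 1)) (unitOnes (N + 1)) := by
      rw [hF, hG, transpose_fromCols, ← Matrix.mul_assoc, fromCols_mul_fromBlocks,
        fromCols_mul_fromRows, Matrix.mul_zero, Matrix.mul_zero, zero_add, add_zero]
      congr 1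
      ext i j
      simp [Matrix.mul_apply, vecMulVec_apply]
      ring
    rw [h1]
    have h2 : A * onesCompl N = onesCompl M * onesReduce A := by
      conv_lhs => rw [hA.eq_reduce]
      rw [Matrix.add_mul, Matrix.mul_assoc, onesCompl_transpose_mul, Matrix.mul_one,
        Matrix.smul_mul, vecMulVec_mul, unitOnes_vecMul_onesCompl]
      ext i j
      simp [vecMulVec_apply]
    have h3 : onesCompl N * ((onesReduce A)ᵀ * onesReduce A) * (onesCompl N)ᵀ =
        (onesCompl N * (onesCompl N)ᵀ) * (Aᵀ * A) * (onesCompl N * (onesCompl N)ᵀ) := by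
      have h4 : (onesReduce A)ᵀ * onesReduce A =
          (onesCompl M * onesReduce A)ᵀ * (onesCompl M * onesReduce A) := by
        rw [transpose_mul, Matrix.mul_assoc, ← Matrix.mul_assoc (onesCompl M)ᵀ,
          onesCompl_transpose_mul, Matrix.one_mul]
      rw [h4, ← h2, transpose_mul]
      simp only [Matrix.mul_assoc]
    have h5 : (Aᵀ * A) *ᵥ unitOnes (N + 1) = a ^ 2 • unitOnes (N + 1) := by
      rw [← mulVec_mulVec, hA.1, mulVec_smul, hA.2, smul_smul, pow_two]
    have h6 : unitOnes (N + 1) ᵥ* (Aᵀ * A) = a ^ 2 • unitOnes (N + 1) := by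
      rw [← mulVec_transpose, transpose_mul, transpose_transpose, h5]
    rw [h3, eq_sub_of_add_eq (onesCompl_mul_transpose N), Matrix.sub_mul, Matrix.one_mul,
      vecMulVec_mul, h6, Matrix.mul_sub, Matrix.mul_one, Matrix.sub_mul, mul_vecMulVec, h5,
      vecMulVec_mul_vecMulVec, smul_dotProduct, unitOnes_dotProduct_self]
    simp [vecMulVec_smul, smul_vecMulVec]
  -- `F` is orthogonal but its rows and columns have different index types, so cyclicity of the
  -- characteristic polynomial replaces similarity. The powers of `X` agree and cancel.
  have hcomm := Matrix.charpoly_mul_comm' F (G * Fᵀ)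
  rw [Matrix.mul_assoc, hFF, Matrix.mul_one, ← hAA] at hcomm
  have hcard : Fintype.card (Fin N ⊕ Unit) = Fintype.card (Fin (N + 1)) := by simp
  rw [hcard] at hcomm
  rw [mul_left_cancel₀ (pow_ne_zero _ X_ne_zero) hcomm, hG, charpoly_fromBlocks_zero₁₂, mul_comm]
  congr 1
  simp [Matrix.charpoly, Matrix.charmatrix]

theorem squareSubst_mul (p q : ℝ[X]) : squareSubst (p * q) = squareSubst p * squareSubst q :=
  Polynomial.mul_comp _ _ _

theorem OnesSingular.charpoly_bipartite {A : Matrix (Fin (M + 1)) (Fin (N + 1)) ℝ} {a : ℝ}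
    (hNM : N ≤ M) (hA : OnesSingular A a) :
    (bipartiteMatrix A).charpoly =
      (X ^ 2 - C (a ^ 2)) * (bipartiteMatrix (onesReduce A)).charpoly := by
  rw [_root_.charpoly_bipartite _ (by omega), _root_.charpoly_bipartite _ hNM, hA.charpoly_gram, squareSubst_mul]
  have : squareSubst (X - C (a ^ 2)) = X ^ 2 - C (a ^ 2) := by simp [squareSubst]
  rw [this, Nat.add_sub_add_right]
  ring

theorem signedPerm_conj_apply (B : Matrix (Fin M) (Fin N) ℝ) (ε : Fin M → ℤˣ) (δ : Fin N → ℤˣ)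
    (σ : Equiv.Perm (Fin M)) (τ : Equiv.Perm (Fin N)) :
    signedPerm ε σ * B * (signedPerm δ τ)ᵀ =
      Matrix.of fun a b => (((ε a * δ b : ℤˣ) : ℤ) : ℝ) * B (σ a) (τ b) := by
  have h : ∀ {r s : ℕ} (ε : Fin r → ℤˣ) (σ : Equiv.Perm (Fin r)) (B : Matrix (Fin r) (Fin s) ℝ),
      signedPerm ε σ * B = Matrix.of fun a b => ((ε a : ℤ) : ℝ) * B (σ a) b := by
    intro r s ε σ B
    ext a b
    rw [signedPerm, Matrix.mul_assoc, Matrix.diagonal_mul]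
    simp [Matrix.mul_apply, Matrix.one_apply]
  have h2 : ∀ B : Matrix (Fin M) (Fin N) ℝ, B * (signedPerm δ τ)ᵀ = (signedPerm δ τ * Bᵀ)ᵀ := by
    intro B
    rw [transpose_mul, transpose_transpose]
  rw [h2, h, h]
  ext a b
  simp
  ring

/-- Row and column invariance inserts an arbitrary signed permutation of each complement. Moving `σ`
and `τ` onto `A` leaves the reduced `B` in the form needed for the signed average. -/
theorem sum_perm_charpoly_add_eq (hNM : N ≤ M) {A B : Matrix (Fin (M + 1)) (Fin (N + 1)) ℝ}
    {a b : ℝ} (hA : OnesSingular A a) (hB : OnesSingular B b) (σ' : Equiv.Perm (Fin M))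
    (τ' : Equiv.Perm (Fin N)) (ε : Fin M ⊕ Fin N → ℤˣ) :
    (∑ σ : Equiv.Perm (Fin (M + 1)), ∑ τ : Equiv.Perm (Fin (N + 1)),
      (bipartiteMatrix (A + B.submatrix σ τ)).charpoly) =
    ∑ σ : Equiv.Perm (Fin (M + 1)), ∑ τ : Equiv.Perm (Fin (N + 1)),
      (X ^ 2 - C ((a + b) ^ 2)) * (bipartiteMatrix (onesReduce (A.submatrix σ.symm τ.symm) +
        Matrix.of fun a b => (((ε (.inl a) * ε (.inr b) : ℤˣ) : ℤ) : ℝ) *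
          onesReduce B (σ' a) (τ' b))).charpoly := by
  rw [← sum_perm_perm_invariant
    (rowInvariant_onesExtend_signedPerm (fun a => ε (.inl a)) σ')
    (rowInvariant_onesExtend_signedPerm (fun b => ε (.inr b)) τ')]
  refine Finset.sum_congr rfl fun σ _ => Finset.sum_congr rfl fun τ _ => ?_
  rw [← signedPerm_conj_apply (onesReduce B) (fun a => ε (.inl a)) (fun b => ε (.inr b)),
    ← onesReduce_conj]
  have hs := (hA.submatrix σ.symm τ.symm).add (hB.conj (signedPerm (fun a => ε (.inl a)) σ')
    (signedPerm (fun b => ε (.inr b)) τ'))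
  have h1 := hs.charpoly_bipartite hNM
  rw [← charpoly_bipartite_submatrix _ σ τ] at h1
  have h2 : ∀ C D : Matrix (Fin (M + 1)) (Fin (N + 1)) ℝ,
      onesReduce C + onesReduce D = onesReduce (C + D) := by
    intro C D
    simp only [onesReduce, Matrix.mul_add, Matrix.add_mul]
  rw [h2, ← h1]
  congr 2
  ext i j
  simp

theorem sum_rotate {α β γ R : Type*} [Fintype α] [Fintype β] [Fintype γ] [AddCommMonoid R]
    (f : α → β → γ → R) : (∑ a, ∑ b, ∑ c, f a b c) = ∑ b, ∑ c, ∑ a, f a b c := by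
  rw [Finset.sum_comm]
  exact Finset.sum_congr rfl fun b _ => Finset.sum_comm

/-- The average over two random permutations for two summands. -/
theorem sum_perm_charpoly_add (hNM : N ≤ M) {A B : Matrix (Fin (M + 1)) (Fin (N + 1)) ℝ} {a b : ℝ}
    (hA : OnesSingular A a) (hB : OnesSingular B b) {p q : ℝ[X]}
    (hp : (Aᵀ * A).charpoly = (X - C (a ^ 2)) * p) (hq : (Bᵀ * B).charpoly = (X - C (b ^ 2)) * q) :
    (∑ σ : Equiv.Perm (Fin (M + 1)), ∑ τ : Equiv.Perm (Fin (N + 1)),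
      (bipartiteMatrix (A + B.submatrix σ τ)).charpoly) =
      C ((M + 1).factorial * (N + 1).factorial : ℝ) * ((X ^ 2 - C ((a + b) ^ 2)) *
        (X ^ (M - N) * squareSubst (rectConv M N p q))) := by
  have hred : ∀ {A : Matrix (Fin (M + 1)) (Fin (N + 1)) ℝ} {a : ℝ} {p : ℝ[X]},
      OnesSingular A a → (Aᵀ * A).charpoly = (X - C (a ^ 2)) * p →
      (bipartiteMatrix (onesReduce A)).charpoly = X ^ (M - N) * squareSubst p := by
    intro A a p hA hp
    rw [_root_.charpoly_bipartite _ hNM, mul_left_cancel₀ (X_sub_C_ne_zero _)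
      (hA.charpoly_gram.symm.trans hp)]
  have hgram : ∀ (σ : Equiv.Perm (Fin (M + 1))) (τ : Equiv.Perm (Fin (N + 1))),
      ((A.submatrix σ τ)ᵀ * A.submatrix σ τ).charpoly = (X - C (a ^ 2)) * p := by
    intro σ τ
    rw [transpose_submatrix, submatrix_mul_equiv, ← hp,
      ← Matrix.charpoly_reindex τ.symm (Aᵀ * A), Matrix.reindex_apply, Equiv.symm_symm]
  set Φ := ∑ σ : Equiv.Perm (Fin (M + 1)), ∑ τ : Equiv.Perm (Fin (N + 1)),
      (bipartiteMatrix (A + B.submatrix σ τ)).charpoly with hΦ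
  have hinv := sum_perm_charpoly_add_eq hNM hA hB
  simp only [← hΦ] at hinv
  -- The sum `Φ` does not depend on the inserted signed permutations, so it may be summed over all
  -- of them and the orders of summation exchanged.
  have hsum : ((Fintype.card (Equiv.Perm (Fin M)) * (Fintype.card (Equiv.Perm (Fin N)) *
      Fintype.card (Fin M ⊕ Fin N → ℤˣ)) : ℕ) : ℝ[X]) * Φ =
      ∑ σ' : Equiv.Perm (Fin M), ∑ τ' : Equiv.Perm (Fin N), ∑ ε : Fin M ⊕ Fin N → ℤˣ, Φ := by
    simp only [Finset.sum_const, Finset.card_univ, nsmul_eq_mul]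
    push_cast
    ring
  rw [Finset.sum_congr rfl fun σ' _ => Finset.sum_congr rfl fun τ' _ =>
    Finset.sum_congr rfl fun ε _ => hinv σ' τ' ε] at hsum
  have hcomm : ∀ f : Equiv.Perm (Fin M) → Equiv.Perm (Fin N) → (Fin M ⊕ Fin N → ℤˣ) →
      Equiv.Perm (Fin (M + 1)) → Equiv.Perm (Fin (N + 1)) → ℝ[X],
      (∑ σ', ∑ τ', ∑ ε, ∑ σ, ∑ τ, f σ' τ' ε σ τ) = ∑ σ, ∑ τ, ∑ σ', ∑ τ', ∑ ε, f σ' τ' ε σ τ := by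
    intro f
    rw [Finset.sum_congr rfl fun σ' _ => Finset.sum_congr rfl fun τ' _ => sum_rotate _,
      Finset.sum_congr rfl fun σ' _ => sum_rotate _, sum_rotate]
  rw [hcomm] at hsum
  have hterm : ∀ (σ : Equiv.Perm (Fin (M + 1))) (τ : Equiv.Perm (Fin (N + 1))),
      (∑ σ' : Equiv.Perm (Fin M), ∑ τ' : Equiv.Perm (Fin N), ∑ ε : Fin M ⊕ Fin N → ℤˣ,
        (X ^ 2 - C ((a + b) ^ 2)) * (bipartiteMatrix (onesReduce (A.submatrix σ.symm τ.symm) +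
          Matrix.of fun a b => (((ε (.inl a) * ε (.inr b) : ℤˣ) : ℤ) : ℝ) *
            onesReduce B (σ' a) (τ' b))).charpoly) =
      (X ^ 2 - C ((a + b) ^ 2)) * (C (2 ^ (M + N) * (M.factorial * N.factorial) : ℝ) *
        (X ^ (M - N) * squareSubst (rectConv M N p q))) := by
    intro σ τ
    rw [← sum_signedPerm_charpoly hNM _ _ p q
      (hred (hA.submatrix σ.symm τ.symm) (hgram σ.symm τ.symm)) (hred hB hq)]
    simp only [Finset.mul_sum]
  simp only [hterm, Finset.sum_const, Finset.card_univ, Fintype.card_perm, Fintype.card_fin,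
    nsmul_eq_mul, Fintype.card_fun, Fintype.card_sum, Fintype.card_units_int] at hsum
  have hne : ((M.factorial * (N.factorial * 2 ^ (M + N)) : ℕ) : ℝ[X]) ≠ 0 := by
    rw [Nat.cast_ne_zero]
    positivity
  apply mul_left_cancel₀ hne
  rw [hsum]
  simp only [map_mul, map_pow, map_natCast, map_ofNat]
  push_cast
  ring

end TwoSummands

/-! ### Induction on the number of summands -/

section Iteration

open Matrix

variable {m n : ℕ}

theorem permSum_conj (A : Matrix (Fin m) (Fin n) ℝ) (σ : Equiv.Perm (Fin m))
    (τ : Equiv.Perm (Fin n)) :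
    permSum σ τ * bipartiteMatrix A * (permSum σ τ).transpose =
      bipartiteMatrix (A.submatrix σ τ) := by
  have h : ∀ {r s : ℕ} (σ : Equiv.Perm (Fin r)) (B : Matrix (Fin r) (Fin s) ℝ),
      σ.permMatrix ℝ * B = B.submatrix σ id := fun σ B => PEquiv.toMatrix_toPEquiv_mul σ B
  have h' : ∀ {r s : ℕ} (σ : Equiv.Perm (Fin r)) (B : Matrix (Fin s) (Fin r) ℝ),
      B * (σ.permMatrix ℝ)ᵀ = B.submatrix id σ := by
    intro r s σ B
    rw [← transpose_transpose B, ← transpose_mul, h]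
    rfl
  simp only [permSum, bipartiteMatrix, fromBlocks_transpose, fromBlocks_multiply, transpose_zero,
    Matrix.zero_mul, Matrix.mul_zero, zero_add, add_zero, h, h', submatrix_submatrix,
    transpose_submatrix, Function.id_comp, Function.comp_id]
  rfl

theorem sum_bipartiteMatrix {ι : Type*} (s : Finset ι) (A : ι → Matrix (Fin m) (Fin n) ℝ) :
    ∑ i ∈ s, bipartiteMatrix (A i) = bipartiteMatrix (∑ i ∈ s, A i) := by
  ext (a | a) (b | b) <;> simp [bipartiteMatrix, Matrix.sum_apply]

/-- The rectangular convolution with `q` on the right as a linear map. -/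
def rectConvRight (m n : ℕ) (q : ℝ[X]) : ℝ[X] →ₗ[ℝ] ℝ[X] where
  toFun p := rectConv m n p q
  map_add' p p' := by
    simp only [rectConv, signedCoeff, coeff_add, mul_add, add_mul, Finset.sum_add_distrib, C_add]
  map_smul' c p := by
    simp only [rectConv, signedCoeff, coeff_smul, smul_eq_mul, RingHom.id_apply, Finset.smul_sum]
    simp only [Polynomial.smul_eq_C_mul]
    refine Finset.sum_congr rfl fun l _ => ?_
    rw [← mul_assoc, ← C_mul]
    congr 2
    simp only [Finset.mul_sum]
    refine Finset.sum_congr rfl fun ij _ => ?_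
    ring

/-- Two factors are the least possible here: a one-element list is returned unchanged, not convolved
with `X ^ n`. -/
theorem rectConvList_ofFn_succ (m n k : ℕ) (p : Fin (k + 2) → ℝ[X]) :
    rectConvList m n (List.ofFn p) =
      rectConv m n (rectConvList m n (List.ofFn fun i : Fin (k + 1) => p i.castSucc))
        (p (Fin.last _)) := by
  rw [List.ofFn_succ_last, List.ofFn_succ]
  simp [rectConvList]

theorem sum_perm_snoc {k : ℕ} (f : (Fin (k + 1) → Equiv.Perm (Fin m)) →
      (Fin (k + 1) → Equiv.Perm (Fin n)) → ℝ[X]) :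
    (∑ P, ∑ S, f P S) = ∑ P : Fin k → Equiv.Perm (Fin m), ∑ S : Fin k → Equiv.Perm (Fin n),
      ∑ σ : Equiv.Perm (Fin m), ∑ τ : Equiv.Perm (Fin n),
        f (Fin.snoc (α := fun _ => Equiv.Perm (Fin m)) P σ)
          (Fin.snoc (α := fun _ => Equiv.Perm (Fin n)) S τ) := by
  rw [← Equiv.sum_comp (Fin.snocEquiv fun _ => Equiv.Perm (Fin m)), Fintype.sum_prod_type,
    Finset.sum_comm]
  refine Finset.sum_congr rfl fun P _ => ?_
  rw [Finset.sum_comm (s := (Finset.univ : Finset (Fin k → Equiv.Perm (Fin n))))]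
  refine Finset.sum_congr rfl fun σ _ => ?_
  rw [← Equiv.sum_comp (Fin.snocEquiv fun _ => Equiv.Perm (Fin n)), Fintype.sum_prod_type,
    Finset.sum_comm]
  rfl

variable {M N : ℕ}

theorem OnesSingular.sum {ι : Type*} (s : Finset ι)
    {A : ι → Matrix (Fin (M + 1)) (Fin (N + 1)) ℝ} {a : ι → ℝ}
    (hA : ∀ i, OnesSingular (A i) (a i)) : OnesSingular (∑ i ∈ s, A i) (∑ i ∈ s, a i) := by
  classical
  induction s using Finset.induction_on with
  | empty => exact ⟨by simp, by simp⟩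
  | insert i s hi ih =>
    rw [Finset.sum_insert hi, Finset.sum_insert hi]
    exact (hA i).add ih

theorem squareSubst_injective : Function.Injective squareSubst := by
  intro p q h
  simp only [squareSubst, ← Polynomial.expand_eq_comp_X_pow] at h
  exact Polynomial.expand_injective two_pos h

theorem X_sq_sub_C_ne_zero (c : ℝ) : (X ^ 2 - C c : ℝ[X]) ≠ 0 :=
  (Polynomial.monic_X_pow_sub_C c two_ne_zero).ne_zero

theorem sum_perm_charpoly_sum (hNM : N ≤ M) {k : ℕ}
    (A : Fin (k + 1) → Matrix (Fin (M + 1)) (Fin (N + 1)) ℝ) (a : Fin (k + 1) → ℝ)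
    (p : Fin (k + 1) → ℝ[X]) (hA : ∀ i, OnesSingular (A i) (a i))
    (hp : ∀ i, ((A i)ᵀ * A i).charpoly = (X - C (a i ^ 2)) * p i) :
    (∑ P : Fin (k + 1) → Equiv.Perm (Fin (M + 1)), ∑ S : Fin (k + 1) → Equiv.Perm (Fin (N + 1)),
      (bipartiteMatrix (∑ i, (A i).submatrix (P i) (S i))).charpoly) =
      C (((M + 1).factorial * (N + 1).factorial : ℝ) ^ (k + 1)) *
        ((X ^ 2 - C ((∑ i, a i) ^ 2)) *
          (X ^ (M - N) * squareSubst (rectConvList M N (List.ofFn p)))) := by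
  induction k with
  | zero =>
    have h : (bipartiteMatrix (A 0)).charpoly =
        (X ^ 2 - C (a 0 ^ 2)) * (X ^ (M - N) * squareSubst (p 0)) := by
      rw [_root_.charpoly_bipartite _ (by omega), hp, squareSubst_mul, Nat.add_sub_add_right]
      simp only [squareSubst, sub_comp, X_comp, C_comp]
      ring
    simp only [Fin.sum_univ_succ, Finset.univ_eq_empty, Finset.sum_empty, add_zero,
      charpoly_bipartite_submatrix, Finset.sum_const, Finset.card_univ,
      nsmul_eq_mul, Fintype.card_fun, Fintype.card_perm, Fintype.card_fin, h,
      List.ofFn_succ, List.ofFn_zero, rectConvList, List.foldl_nil]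
    simp only [map_mul, map_pow, map_natCast]
    push_cast
    ring
  | succ k ih =>
    have ih' := ih (fun i => A i.castSucc) (fun i => a i.castSucc) (fun i => p i.castSucc)
      (fun i => hA _) (fun i => hp _)
    set B : (Fin (k + 1) → Equiv.Perm (Fin (M + 1))) → (Fin (k + 1) → Equiv.Perm (Fin (N + 1))) →
      Matrix (Fin (M + 1)) (Fin (N + 1)) ℝ := fun P S =>
        ∑ i, (A i.castSucc).submatrix (P i) (S i) with hB
    set b := ∑ i : Fin (k + 1), a i.castSucc with hb
    have hBb : ∀ P S, OnesSingular (B P S) b := fun P S =>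
      OnesSingular.sum _ fun i => (hA i.castSucc).submatrix (P i) (S i)
    set q : (Fin (k + 1) → Equiv.Perm (Fin (M + 1))) → (Fin (k + 1) → Equiv.Perm (Fin (N + 1))) →
      ℝ[X] := fun P S => ((onesReduce (B P S))ᵀ * onesReduce (B P S)).charpoly with hq
    have hBq : ∀ P S, ((B P S)ᵀ * B P S).charpoly = (X - C (b ^ 2)) * q P S := fun P S =>
      (hBb P S).charpoly_gram
    have hBbip : ∀ P S, (bipartiteMatrix (B P S)).charpoly =
        (X ^ 2 - C (b ^ 2)) * (X ^ (M - N) * squareSubst (q P S)) := fun P S => by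
      rw [(hBb P S).charpoly_bipartite hNM, _root_.charpoly_bipartite _ hNM]
    set c : ℝ := (M + 1).factorial * (N + 1).factorial with hc
    clear_value c
    set L := rectConvList M N (List.ofFn fun i : Fin (k + 1) => p i.castSucc) with hL
    -- The polynomial `q P S` varies with the permutations, but by linearity of `rectConv` only its
    -- sum matters. The induction hypothesis gives that sum after cancelling the common factors.
    have hqsum : ∑ P, ∑ S, q P S = C (c ^ (k + 1)) * L := by
      apply squareSubst_injective
      apply mul_left_cancel₀ (pow_ne_zero (M - N) (X_ne_zero (R := ℝ)))
      apply mul_left_cancel₀ (X_sq_sub_C_ne_zero (b ^ 2))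
      have h1 : squareSubst (C (c ^ (k + 1)) * L) = C (c ^ (k + 1)) * squareSubst L := by
        rw [squareSubst_mul]
        simp [squareSubst]
      have h2 : squareSubst (∑ P, ∑ S, q P S) = ∑ P, ∑ S, squareSubst (q P S) := by
        simp only [squareSubst, Polynomial.sum_comp]
      rw [h1, h2]
      have h3 : ∑ P, ∑ S, (bipartiteMatrix (B P S)).charpoly = _ := ih'
      simp only [hBbip, ← Finset.mul_sum] at h3
      rw [h3]
      ring
    rw [sum_perm_snoc]
    have hterm : ∀ P S, (∑ σ : Equiv.Perm (Fin (M + 1)), ∑ τ : Equiv.Perm (Fin (N + 1)),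
        (bipartiteMatrix (∑ i : Fin (k + 2), (A i).submatrix
          (Fin.snoc (α := fun _ => Equiv.Perm (Fin (M + 1))) P σ i : Equiv.Perm (Fin (M + 1)))
          (Fin.snoc (α := fun _ => Equiv.Perm (Fin (N + 1))) S τ i :
            Equiv.Perm (Fin (N + 1))))).charpoly) =
        C c * ((X ^ 2 - C ((b + a (Fin.last _)) ^ 2)) *
          (X ^ (M - N) * squareSubst (rectConvRight M N (p (Fin.last _)) (q P S)))) := by
      intro P S
      have := sum_perm_charpoly_add hNM (hBb P S) (hA (Fin.last _)) (hBq P S) (hp (Fin.last _))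
      rw [← hc] at this
      refine Eq.trans (Finset.sum_congr rfl fun σ _ => Finset.sum_congr rfl fun τ _ => ?_) this
      rw [Fin.sum_univ_castSucc]
      simp only [Fin.snoc_castSucc, Fin.snoc_last, hB]
    simp only [hterm, ← Finset.mul_sum]
    have h3 : (∑ P, ∑ S, squareSubst (rectConvRight M N (p (Fin.last _)) (q P S))) =
        C (c ^ (k + 1)) * squareSubst (rectConv M N L (p (Fin.last _))) := by
      have h4 : (∑ P, ∑ S, squareSubst (rectConvRight M N (p (Fin.last _)) (q P S))) =
          squareSubst (rectConvRight M N (p (Fin.last _)) (∑ P, ∑ S, q P S)) := by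
        simp only [squareSubst, Polynomial.sum_comp, map_sum]
      rw [h4, hqsum, ← Polynomial.smul_eq_C_mul, map_smul, Polynomial.smul_eq_C_mul,
        squareSubst_mul]
      congr 1
      simp [squareSubst]
    rw [h3, rectConvList_ofFn_succ, Fin.sum_univ_castSucc, pow_succ c (k + 1), C_mul, ← hb, ← hL]
    ring

theorem sum_sum_eq_card_mul_expect {α β : Type*} [Fintype α] [Fintype β] (f : α → β → ℝ[X]) :
    (∑ a, ∑ b, f a b) = ((Fintype.card α * Fintype.card β : ℕ) : ℝ[X]) *
      Finset.univ.expect fun a => Finset.univ.expect fun b => f a b := by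
  rw [← nsmul_eq_mul, mul_smul, Finset.smul_expect, ← Finset.card_univ (α := α),
    Finset.card_smul_expect]
  refine Finset.sum_congr rfl fun a _ => ?_
  rw [← Finset.card_univ, Finset.card_smul_expect]

end Iteration

end

theorem corollary2p8 (m n k : ℕ) (hn : 1 ≤ n) (hmn : n ≤ m)
    (A : Fin k → Matrix (Fin m) (Fin n) ℝ) (a : Fin k → ℝ) (p : Fin k → ℝ[X])
    (hA : ∀ i, (A i).mulVec (unitOnes n) = a i • unitOnes m)
    (hAT : ∀ i, (A i).transpose.mulVec (unitOnes m) = a i • unitOnes n)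
    (hp : ∀ i, ((A i).transpose * A i).charpoly = (X - C (a i ^ 2)) * p i) :
    (Finset.univ.expect fun P : Fin k → Equiv.Perm (Fin m) =>
      Finset.univ.expect fun S : Fin k → Equiv.Perm (Fin n) =>
        (∑ i, permSum (P i) (S i) * bipartiteMatrix (A i) *
          (permSum (P i) (S i)).transpose).charpoly) =
      X ^ (m - n) * ((X ^ 2 - C ((∑ i, a i) ^ 2)) *
        squareSubst (rectConvList (m - 1) (n - 1) (List.ofFn p))) := by
  obtain ⟨N, rfl⟩ : ∃ N, n = N + 1 := ⟨n - 1, by omega⟩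
  obtain ⟨M, rfl⟩ : ∃ M, m = M + 1 := ⟨m - 1, by omega⟩
  simp only [permSum_conj, sum_bipartiteMatrix]
  rw [Nat.add_sub_add_right, Nat.add_sub_cancel, Nat.add_sub_cancel]
  have hNM : N ≤ M := by omega
  rcases k with _ | k
  -- For `k = 0` the sum is the zero matrix, and the degrees match: `(m - n) + 2 + 2 * (n - 1) = m +
  -- n`.
  · have h0 : (bipartiteMatrix (0 : Matrix (Fin (M + 1)) (Fin (N + 1)) ℝ)) = 0 := by
      simp [bipartiteMatrix]
    simp only [Finset.univ_eq_empty, Finset.sum_empty, h0, Matrix.charpoly_zero,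
      Finset.expect_const Finset.univ_nonempty, List.ofFn_zero, rectConvList, squareSubst]
    simp only [Fintype.card_sum, Fintype.card_fin, ne_eq, OfNat.ofNat_ne_zero, not_false_eq_true,
      zero_pow, C_0, sub_zero, pow_comp, X_comp]
    rw [← pow_mul, ← pow_add, ← pow_add]
    congr 1
    omega
  · have h := sum_perm_charpoly_sum hNM A a p (fun i => ⟨hA i, hAT i⟩) hp
    rw [sum_sum_eq_card_mul_expect] at h
    simp only [Fintype.card_fun, Fintype.card_perm, Fintype.card_fin] at h
    have hne : ((((M + 1).factorial ^ (k + 1) * (N + 1).factorial ^ (k + 1) : ℕ)) : ℝ[X]) ≠ 0 := by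
      rw [Nat.cast_ne_zero]
      positivity
    apply mul_left_cancel₀ hne
    rw [h]
    simp only [map_mul, map_pow, map_natCast]
    push_cast
    ring
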